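/- Let $R$ be a reduced Noetherian commutative ring of Krull dimension one with total ring of fractions $K$, let $\Lambda$ be a semi-simple $K$-algebra, and let $A\subset\Lambda$ be a central $R$-order, i.e. an $R$-subalgebra that is finitely generated as an $R$-module, with $K\cdot A=\Lambda$ and whose centre is $Z(A)=R$. Let $S$ be a simple left $A$-module, $F:=\operatorname{End}_A(S)$ the corresponding skew field, and $\operatorname{Supp}_R(S)=\{\mathfrak m\}$, where $\mathfrak m$ has height one (this holds automatically if $R$ is connected, or more generally if all maximal ideals of $R$ have height one). Then the $R_{\mathfrak m}$-order $A_{\mathfrak m}$ in $\Lambda_{\mathfrak m}$ is maximal (that is, no $R_{\mathfrak m}$-order in $\Lambda_{\mathfrak m}$ properly contains it) if and only if both of the following conditions hold: 1. the left $F$-module $\operatorname{Ext}^1_A(S,S)$ has length one; 2. $\operatorname{Ext}^1_A(S,T)=0$ for every simple left $A$-module $T\not\cong S$. -/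

import Mathlib

open CategoryTheory TensorProduct

universe u v

/-- A subalgebra `A` of an `R`-algebra `Λ` is an `R`-*order in* `Λ` if it is a finitely generated
`R`-module and every element of `Λ` is carried into `A` by some non-zero-divisor of `R`.
If `Λ` is an algebra over the total ring of fractions `K` of `R`, the second condition says that
`K · A = Λ`, see `isOrder_iff_span_eq_top`. -/
structure IsOrder {R : Type*} {Λ : Type*} [CommRing R] [Ring Λ] [Algebra R Λ]
    (A : Subalgebra R Λ) : Prop where
  fg : (Subalgebra.toSubmodule A).FG
  exists_smul_mem : ∀ x : Λ, ∃ r ∈ nonZeroDivisors R, r • x ∈ A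

theorem isOrder_iff_span_eq_top {R : Type*} (K : Type*) {Λ : Type*} [CommRing R] [CommRing K]
    [Algebra R K] [IsFractionRing R K] [Ring Λ] [Algebra R Λ] [Algebra K Λ] [IsScalarTower R K Λ]
    (A : Subalgebra R Λ) :
    IsOrder A ↔ (Subalgebra.toSubmodule A).FG ∧ Submodule.span K (A : Set Λ) = ⊤ := by
  constructor
  · rintro ⟨h, h'⟩
    refine ⟨h, eq_top_iff.2 fun x _ => ?_⟩
    obtain ⟨r, hr, hx⟩ := h' x
    have hu : IsUnit (algebraMap R K r) := IsLocalization.map_units K ⟨r, hr⟩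
    obtain ⟨u, hu⟩ := hu
    have : x = (↑u⁻¹ : K) • (r • x) := by
      rw [← algebraMap_smul K r x, smul_smul, ← hu, Units.inv_mul, one_smul]
    rw [this]
    exact Submodule.smul_mem _ _ (Submodule.subset_span hx)
  · rintro ⟨h, h'⟩
    refine ⟨h, fun x => ?_⟩
    have hx : x ∈ Submodule.span K (A : Set Λ) := h' ▸ Submodule.mem_top
    induction hx using Submodule.span_induction with
    | mem x hx => exact ⟨1, one_mem _, by simpa using hx⟩
    | zero => exact ⟨1, one_mem _, by simp⟩
    | add x y _ _ hx hy =>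
      obtain ⟨r, hr, hx⟩ := hx
      obtain ⟨s, hs, hy⟩ := hy
      refine ⟨r * s, mul_mem hr hs, ?_⟩
      rw [smul_add]
      refine add_mem ?_ ?_
      · rw [mul_comm, mul_smul]; exact A.smul_mem hx s
      · rw [mul_smul]; exact A.smul_mem hy r
    | smul k x _ hx =>
      obtain ⟨r, hr, hx⟩ := hx
      obtain ⟨⟨a, s⟩, hs⟩ := IsLocalization.surj (nonZeroDivisors R) k
      refine ⟨s * r, mul_mem s.2 hr, ?_⟩
      have : ((s : R) * r) • k • x = a • r • x := by
        rw [mul_comm, mul_smul, ← algebraMap_smul K (s : R) (k • x), smul_smul, mul_comm, hs,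
          algebraMap_smul, smul_comm]
      rw [this]
      exact A.smul_mem hx a

/-- An order in `Λ` is *maximal* if it has no proper overorder in `Λ`. -/
structure IsMaximalOrder {R : Type*} {Λ : Type*} [CommRing R] [Ring Λ] [Algebra R Λ]
    (A : Subalgebra R Λ) : Prop where
  isOrder : IsOrder A
  eq_of_le : ∀ B : Subalgebra R Λ, IsOrder B → A ≤ B → B = A

/-- An order `A` is *central* if the structure map identifies `R` with the centre of `A`. -/
structure IsCentralOrder {R : Type*} {Λ : Type*} [CommRing R] [Ring Λ] [Algebra R Λ]
    (A : Subalgebra R Λ) : Prop where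
  isOrder : IsOrder A
  injective : Function.Injective (algebraMap R A)
  center_eq : Subalgebra.center R A = ⊥

/-- The localization `A_𝔪 ⊆ Λ_𝔪` of an order `A ⊆ Λ`, where `Λ_𝔪 = R_𝔪 ⊗_R Λ`. -/
noncomputable abbrev localizedOrder {R : Type*} {Λ : Type*} [CommRing R] [Ring Λ] [Algebra R Λ]
    (A : Subalgebra R Λ) (m : PrimeSpectrum R) :
    Subalgebra (Localization.AtPrime m.asIdeal) (Localization.AtPrime m.asIdeal ⊗[R] Λ) :=
  A.baseChange (Localization.AtPrime m.asIdeal)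

/-- The left `End_A(N)`-module structure on `Extⁿ_A(M, N)`, by functoriality in `N`. -/
noncomputable instance extModuleEnd {A : Type v} [Ring A] (M N : Type v) [AddCommGroup M]
    [Module A M] [AddCommGroup N] [Module A N] (n : ℕ) :
    Module (Module.End A N) (Abelian.Ext (ModuleCat.of A M) (ModuleCat.of A N) n) where
  smul f e := e.comp (Abelian.Ext.mk₀ (ModuleCat.ofHom f)) (add_zero n)
  one_smul e := Abelian.Ext.comp_mk₀_id e
  mul_smul f g e := by
    change e.comp (Abelian.Ext.mk₀ (ModuleCat.ofHom (f * g))) (add_zero n) =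
      (e.comp (Abelian.Ext.mk₀ (ModuleCat.ofHom g)) (add_zero n)).comp
        (Abelian.Ext.mk₀ (ModuleCat.ofHom f)) (add_zero n)
    rw [Abelian.Ext.comp_assoc_of_third_deg_zero, Abelian.Ext.mk₀_comp_mk₀]
    rfl
  smul_zero f := by
    change (0 : Abelian.Ext (ModuleCat.of A M) (ModuleCat.of A N) n).comp
      (Abelian.Ext.mk₀ (ModuleCat.ofHom f)) (add_zero n) = 0
    rw [Abelian.Ext.zero_comp]
  smul_add f e e' := Abelian.Ext.add_comp _ _ _ _
  add_smul f g e := by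
    change e.comp (Abelian.Ext.mk₀ (ModuleCat.ofHom f + ModuleCat.ofHom g)) (add_zero n) = _
    rw [Abelian.Ext.mk₀_add, Abelian.Ext.comp_add]
    rfl
  zero_smul e := by
    change e.comp (Abelian.Ext.mk₀ 0) (add_zero n) = 0
    rw [Abelian.Ext.mk₀_zero, Abelian.Ext.comp_zero]

/-!
Write `P` for the annihilator of `S` in `A`, `L` for `Λ_𝔪`, `B` for the order `A_𝔪` in `L`, and `I`
for the localization of `P`. The module `S` is killed by `𝔪`, and `A / P` is a direct sum of copies
of `S`, so `I` is a maximal two-sided ideal of `B`. From `0 → P → A → A / P → 0` one reads off that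
`Ext¹(S, T) = 0` if and only if every homomorphism `P → T` is of the form `p ↦ p t`
(`subsingleton_ext_iff`), and that `Ext¹(S, S)` has length one if and only if `P / P ^ 2` and `A / P`
have the same length (`length_ext_eq_one_iff`). The theorem thus says that `B` is maximal if and only
if `P` has these two properties, and the link between the two sides is that both amount to `I` being
an invertible ideal.

If `B` is maximal, it is the left and the right order of each of its full two-sided ideals, and this
makes the maximal ideal `I` invertible (`exists_isInverseIdeal`). As the centre of `B` is local, an
invertible proper ideal has a power inside `r B`, where `r ∈ 𝔪` is a non-zero-divisor
(`IsInverseIdeal.exists_pow_le`): otherwise `B` would have a nontrivial central idempotent modulo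
`r`. So `P` is nilpotent modulo `𝔪 A`, and `S` is the only simple module killed by `𝔪`; on any other
simple module some scalar in `𝔪` acts invertibly while it kills `S`, which gives the second condition
(`exists_forall_eq_smul_of_hasNoFiniteOverring`). Multiplication by `I` matches the left ideals above
`P` with the submodules between `P ^ 2` and `P`, which gives the first
(`length_conormal_eq_of_hasNoFiniteOverring`).

Conversely, the first condition makes `P / P ^ 2` isomorphic to `A / P`, hence cyclic, and a generator
lifts to an element `x` of `P` that acts as the identity on all simple modules `T ≄ S` killed by `𝔪`.
A simple quotient of `P / 𝔪 P` isomorphic to `S` factors through `P / P ^ 2`, and a map of `P` onto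
another `T` is `p ↦ p t` by the second condition, with value `t ≠ 0` at `x`; so no simple quotient
kills `x`, which therefore generates `P` modulo `𝔪 P` (`exists_annihilator_le_span_sup`), and
`I = B x` by Nakayama's lemma. The element `x` is a unit of `L` with `x B ⊆ B x`, and since `L` is
semisimple a monic equation for conjugation by `x` on `B` is also one for conjugation by `x⁻¹`
(`sum_mul_mul_swap`), so `x B = B x` and `I` is invertible
(`exists_isInverseIdeal_of_forall_mem_iff`). A finite overring of `B` is then contained in `B`:
multiply it by the least power of `I` that carries it into `B` (`IsInverseIdeal.overring_le`,
`IsLocalOrder.hasNoFiniteOverring`).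
-/


/-! ### Bilinear identities and ideals in semisimple rings -/

section MultiplicationIdentities

variable {L ι : Type*} [Ring L]

/-- In a simple ring, an identity `∑ aᵢ z bᵢ = 0` with `bᵢ` linearly independent over the centre
has `aᵢ = 0`; that is, `L ⊗ Lᵐᵒᵖ` over the centre acts faithfully on `L`. -/
theorem eq_zero_of_sum_mul_mul_eq_zero [IsSimpleRing L] {F : Type*} [Field F] [Algebra F L]
    [Algebra.IsCentral F L] {b : ι → L} (hb : LinearIndependent F b) (s : Finset ι) :
    ∀ a : ι → L, (∀ z, ∑ i ∈ s, a i * z * b i = 0) → ∀ i ∈ s, a i = 0 := by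
  classical
  induction s using Finset.induction_on with
  | empty => simp
  | insert j s hj ih =>
    intro a ha
    -- the coefficients at `j` of all such identities form a two-sided ideal
    let I : Ideal L :=
      { carrier := {c | ∃ a : ι → L, (∀ z, ∑ i ∈ insert j s, a i * z * b i = 0) ∧ a j = c}
        add_mem' := by
          rintro _ _ ⟨a, ha, rfl⟩ ⟨a', ha', rfl⟩
          refine ⟨a + a', fun z => ?_, rfl⟩
          simp only [Pi.add_apply, add_mul, Finset.sum_add_distrib, ha, ha', add_zero]
        zero_mem' := ⟨0, by simp, rfl⟩
        smul_mem' := by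
          rintro c _ ⟨a, ha, rfl⟩
          refine ⟨fun i => c * a i, fun z => ?_, rfl⟩
          simp only [mul_assoc, ← Finset.mul_sum]
          simp only [← mul_assoc, ha, mul_zero] }
    have hI : I.IsTwoSided := by
      refine ⟨fun {c} d hc => ?_⟩
      obtain ⟨a, ha, rfl⟩ := hc
      refine ⟨fun i => a i * d, fun z => ?_, rfl⟩
      simpa only [mul_assoc] using ha (d * z)
    have hj0 : a j = 0 := by
      rcases (isSimpleRing_iff_isTwoSided_imp.1 ‹IsSimpleRing L›).2 I hI with h | h
      · have : a j ∈ I := ⟨a, ha, rfl⟩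
        rwa [h] at this
      · obtain ⟨a', ha', h1⟩ : (1 : L) ∈ I := h ▸ Submodule.mem_top
        exfalso
        -- normalised at `j`, the identity has central coefficients
        have hc : ∀ c, ∀ i ∈ s, c * a' i - a' i * c = 0 := by
          intro c
          refine ih _ fun z => ?_
          have e1 := ha' z
          have e2 := ha' (c * z)
          rw [Finset.sum_insert hj, h1] at e1 e2
          have : ∑ i ∈ s, (c * a' i - a' i * c) * z * b i
              = c * (1 * z * b j + ∑ i ∈ s, a' i * z * b i)
                - (1 * (c * z) * b j + ∑ i ∈ s, a' i * (c * z) * b i) := by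
            simp only [sub_mul, Finset.sum_sub_distrib, mul_add, Finset.mul_sum, mul_assoc, one_mul]
            abel
          rw [this, e1, e2]; simp
        have hcen : ∀ i ∈ insert j s, ∃ k : F, algebraMap F L k = a' i := by
          intro i hi
          have : a' i ∈ Subalgebra.center F L := by
            rw [Subalgebra.mem_center_iff]
            intro c
            rcases Finset.mem_insert.1 hi with rfl | hi
            · rw [h1]; simp
            · exact sub_eq_zero.1 (hc c i hi)
          exact Algebra.mem_bot.1 (Algebra.IsCentral.out this)
        choose! k hk using hcen
        have h0 : ∑ i ∈ insert j s, k i • b i = 0 := by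
          rw [← ha' 1]
          exact Finset.sum_congr rfl fun i hi => by rw [Algebra.smul_def, hk i hi, mul_one]
        have := linearIndependent_iff'.1 hb _ _ h0 j (Finset.mem_insert_self _ _)
        have h2 := hk j (Finset.mem_insert_self _ _)
        rw [this, h1, map_zero] at h2
        exact zero_ne_one h2
    intro i hi
    rcases Finset.mem_insert.1 hi with rfl | hi
    · exact hj0
    · refine ih a (fun z => ?_) i hi
      have := ha z
      rwa [Finset.sum_insert hj, hj0, zero_mul, zero_mul, zero_add] at this

theorem sum_mul_mul_swap_of_isSimpleRing [IsSimpleRing L] (s : Finset ι) (a b : ι → L)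
    (h : ∀ z, ∑ i ∈ s, a i * z * b i = 0) (z : L) : ∑ i ∈ s, b i * z * a i = 0 := by
  classical
  let _ : Field (Subring.center L) := (IsSimpleRing.isField_center L).toField
  have : Algebra.IsCentral (Subring.center L) L := by
    refine ⟨fun x hx => ?_⟩
    rw [Algebra.mem_bot]
    refine ⟨⟨x, ?_⟩, rfl⟩
    rw [Subring.mem_center_iff]
    exact Subalgebra.mem_center_iff.1 hx
  let V : Submodule (Subring.center L) L := Submodule.span _ (b '' s)
  have : Module.Finite (Subring.center L) V :=
    Module.Finite.iff_fg.2 (Submodule.fg_span (s.finite_toSet.image b))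
  let e := Module.finBasis (Subring.center L) V
  have he : LinearIndependent (Subring.center L) (fun j => (e j : L)) :=
    e.linearIndependent.map' V.subtype V.ker_subtype
  have hex : ∀ i ∈ s, ∃ β : Fin _ → Subring.center L, b i = ∑ j, β j • (e j : L) := by
    intro i hi
    have hbi : b i ∈ V := Submodule.subset_span ⟨i, hi, rfl⟩
    refine ⟨e.repr ⟨b i, hbi⟩, ?_⟩
    have := congrArg V.subtype (e.sum_repr ⟨b i, hbi⟩)
    rw [map_sum] at this
    exact this.symm
  choose! β hβ using hex
  have key : ∀ j, ∑ i ∈ s, β i j • a i = 0 := by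
    intro j
    refine eq_zero_of_sum_mul_mul_eq_zero he Finset.univ (fun j => ∑ i ∈ s, β i j • a i)
      (fun z => ?_) j (Finset.mem_univ _)
    rw [← h z]
    simp only [Finset.sum_mul]
    rw [Finset.sum_comm]
    refine Finset.sum_congr rfl fun i hi => ?_
    conv_rhs => rw [hβ i hi]
    simp [Finset.mul_sum]
  have : ∑ i ∈ s, b i * z * a i = ∑ j, (e j : L) * z * ∑ i ∈ s, β i j • a i := by
    simp only [Finset.mul_sum]
    rw [Finset.sum_comm]
    refine Finset.sum_congr rfl fun i hi => ?_
    conv_lhs => rw [hβ i hi]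
    simp [Finset.sum_mul]
  rw [this]
  simp [key]

/-- On a simple factor, either family of sums vanishes if and only if `∑ aᵢ ⊗ bᵢ` is zero over the
centre. -/
theorem sum_mul_mul_swap [IsSemisimpleRing L] (s : Finset ι) (a b : ι → L)
    (h : ∀ z, ∑ i ∈ s, a i * z * b i = 0) (z : L) : ∑ i ∈ s, b i * z * a i = 0 := by
  obtain ⟨n, D, d, _, hd, ⟨e⟩⟩ := IsSemisimpleRing.exists_ringEquiv_pi_matrix_divisionRing L
  apply e.injective
  rw [map_zero]
  funext k
  have := sum_mul_mul_swap_of_isSimpleRing s (fun i => e (a i) k) (fun i => e (b i) k)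
    (fun w => by
      have := congrFun (congrArg e (h (e.symm (Pi.single k w)))) k
      simpa [map_sum, Finset.sum_apply] using this) (e z k)
  simpa [map_sum, Finset.sum_apply] using this

end MultiplicationIdentities

/-- A two-sided ideal of a semisimple ring contains an element acting on it as a left identity. -/
theorem exists_mem_forall_mul_eq_self {Q : Type*} [Ring Q] [IsSemisimpleRing Q] (I : Ideal Q)
    [I.IsTwoSided] : ∃ e ∈ I, ∀ i ∈ I, e * i = i := by
  obtain ⟨I', hI'⟩ := exists_isCompl I
  obtain ⟨e, he, e', he', h1⟩ := Submodule.mem_sup.1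
    (hI'.sup_eq_top ▸ Submodule.mem_top : (1 : Q) ∈ I ⊔ I')
  have hr : ∀ i ∈ I, i * e = i := by
    intro i hi
    have h2 : i * e' = i - i * e := by
      rw [eq_sub_iff_add_eq', ← mul_add, h1, mul_one]
    have : i * e' ∈ I ⊓ I' :=
      ⟨h2 ▸ I.sub_mem hi (I.mul_mem_left _ he), I'.mul_mem_left _ he'⟩
    rw [hI'.inf_eq_bot, Submodule.mem_bot] at this
    rw [this] at h2
    exact (sub_eq_zero.1 h2.symm).symm
  refine ⟨e, he, fun i hi => ?_⟩
  -- `Q y` squares to zero for `y = i - e i`, and a semisimple ring has no such left ideals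
  set y := i - e * i with hy
  have hyI : y ∈ I := I.sub_mem hi (I.mul_mem_left _ hi)
  have hyy : ∀ q, y * (q * y) = 0 := by
    intro q
    have : y * q * e = y * q := hr _ (I.mul_mem_right _ hyI)
    rw [← mul_assoc, hy, mul_sub, ← mul_assoc (_ * q), ← hy, this, sub_self]
  obtain ⟨J', hJ'⟩ := exists_isCompl (Ideal.span {y})
  obtain ⟨f, hf, f', hf', h1'⟩ := Submodule.mem_sup.1
    (hJ'.sup_eq_top ▸ Submodule.mem_top : (1 : Q) ∈ Ideal.span {y} ⊔ J')
  obtain ⟨q, rfl⟩ := Ideal.mem_span_singleton'.1 hf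
  have h3 : y = y * f' := by
    have : y * 1 = _ := congrArg (y * ·) h1'.symm
    rwa [mul_one, mul_add, hyy, zero_add] at this
  have : y ∈ Ideal.span {y} ⊓ J' :=
    ⟨Ideal.mem_span_singleton_self y, h3 ▸ J'.mul_mem_left _ hf'⟩
  rw [hJ'.inf_eq_bot, Submodule.mem_bot] at this
  exact (sub_eq_zero.1 this).symm

theorem isArtinian_quotient_of_smul_top_le {R M : Type*} [CommRing R] [AddCommGroup M] [Module R M]
    [Module.Finite R M] (I : Ideal R) [IsArtinian R (R ⧸ I)] (N : Submodule R M)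
    (hN : I • (⊤ : Submodule R M) ≤ N) : IsArtinian R (M ⧸ N) := by
  obtain ⟨n, f, hf⟩ := Module.Finite.exists_fin' R M
  let g : (Fin n → R ⧸ I) →ₗ[R] M ⧸ N := LinearMap.lsum R (fun _ => R ⧸ I) R fun i =>
    Submodule.liftQ I (LinearMap.toSpanSingleton R (M ⧸ N) (N.mkQ (f (Pi.single i 1)))) (by
      intro r hr
      rw [LinearMap.mem_ker, LinearMap.toSpanSingleton_apply, ← map_smul, Submodule.mkQ_apply,
        Submodule.Quotient.mk_eq_zero]
      exact hN (Submodule.smul_mem_smul hr Submodule.mem_top))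
  refine isArtinian_of_surjective _ g fun x => ?_
  obtain ⟨x, rfl⟩ := N.mkQ_surjective x
  obtain ⟨c, rfl⟩ := hf x
  refine ⟨fun i => Submodule.Quotient.mk (c i), ?_⟩
  have hc : c = ∑ i, c i • Pi.single i (1 : R) := by
    ext j; simp [Finset.sum_apply, Pi.single_apply]
  conv_rhs => rw [hc]
  simp only [g, LinearMap.lsum_apply, LinearMap.sum_apply, LinearMap.comp_apply,
    LinearMap.proj_apply, map_sum, map_smul]
  exact Finset.sum_congr rfl fun i _ => rfl

/-! ### Inverse ideals -/

section Ideals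

variable {R L : Type*} [CommRing R] [Ring L] [Algebra R L]

/-- `I` is an invertible two-sided ideal of `B` with inverse `Y`, all three being `R`-submodules
of the ambient ring `L`. -/
structure IsInverseIdeal (B I Y : Submodule R L) : Prop where
  mul_inv : I * Y = B
  inv_mul : Y * I = B
  mul_left : B * I = I
  mul_right : I * B = I
  inv_mul_left : B * Y = Y
  inv_mul_right : Y * B = Y
  le : I ≤ B

variable {B I Y : Submodule R L}

theorem IsInverseIdeal.pow_mul_left (h : IsInverseIdeal B I Y) (k : ℕ) :
    B * I ^ (k + 1) = I ^ (k + 1) := by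
  rw [pow_succ', ← mul_assoc, h.mul_left]

theorem IsInverseIdeal.pow_mul_right (h : IsInverseIdeal B I Y) (k : ℕ) :
    I ^ (k + 1) * B = I ^ (k + 1) := by
  rw [pow_succ, mul_assoc, h.mul_right]

theorem IsInverseIdeal.inv_pow_mul_left (h : IsInverseIdeal B I Y) (k : ℕ) :
    B * Y ^ (k + 1) = Y ^ (k + 1) := by
  rw [pow_succ', ← mul_assoc, h.inv_mul_left]

theorem IsInverseIdeal.pow_mul_inv_pow (h : IsInverseIdeal B I Y) (k : ℕ) :
    I ^ (k + 1) * Y ^ (k + 1) = B := by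
  induction k with
  | zero => simpa using h.mul_inv
  | succ k ih =>
    rw [pow_succ I, pow_succ' Y, mul_assoc, ← mul_assoc I, h.mul_inv, ← mul_assoc,
      h.pow_mul_right, ih]

theorem IsInverseIdeal.inv_pow_mul_pow (h : IsInverseIdeal B I Y) (k : ℕ) :
    Y ^ (k + 1) * I ^ (k + 1) = B := by
  induction k with
  | zero => simpa using h.inv_mul
  | succ k ih =>
    rw [pow_succ Y, pow_succ' I, mul_assoc, ← mul_assoc Y, h.inv_mul, h.pow_mul_left, ih]

/-- If every two-sided ideal not contained in the invertible ideal `I` is the unit ideal, then an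
overring that some power of `I` multiplies into `B` is contained in `B`. -/
theorem IsInverseIdeal.overring_le (h : IsInverseIdeal B I Y) {C : Submodule R L}
    (h1 : 1 ≤ B) (hBC : B ≤ C) (hC : C * C ≤ C) (hk : ∃ k, I ^ k * C ≤ B)
    (hmax : ∀ M : Submodule R L, B * M ≤ M → M * B ≤ M → M ≤ B → ¬ M ≤ I → B ≤ M) : C ≤ B := by
  classical
  have hle : ∀ N : Submodule R L, N ≤ B * N := fun N => by
    simpa using mul_le_mul' h1 (le_refl N)
  obtain ⟨hs, hmin⟩ : I ^ Nat.find hk * C ≤ B ∧ ∀ j < Nat.find hk, ¬ I ^ j * C ≤ B :=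
    ⟨Nat.find_spec hk, fun j hj => Nat.find_min hk hj⟩
  generalize Nat.find hk = k at hs hmin
  cases k with
  | zero => simpa using hs
  | succ k =>
    have hM : B ≤ I ^ (k + 1) * C := by
      refine hmax _ ?_ ?_ hs fun hMI => hmin k (Nat.lt_succ_self k) ?_
      · rw [← mul_assoc, h.pow_mul_left]
      · rw [mul_assoc]
        exact mul_le_mul' le_rfl ((mul_le_mul' le_rfl hBC).trans hC)
      · calc I ^ k * C ≤ B * (I ^ k * C) := hle _
          _ = Y * (I ^ (k + 1) * C) := by
            rw [pow_succ', mul_assoc I, ← mul_assoc Y, h.inv_mul]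
          _ ≤ Y * I := mul_le_mul' le_rfl hMI
          _ = B := h.inv_mul
    calc C ≤ B * C := hle _
      _ ≤ I ^ (k + 1) * C * C := mul_le_mul' hM le_rfl
      _ ≤ I ^ (k + 1) * C := by
        rw [mul_assoc]; exact mul_le_mul' le_rfl hC
      _ ≤ B := hs

theorem pow_mul_le (hBB : B * B ≤ B) (hI : I ≤ B) (k : ℕ) : I ^ k * B ≤ B := by
  induction k with
  | zero => simp
  | succ k ih =>
    rw [pow_succ, mul_assoc]
    exact (mul_le_mul' le_rfl ((mul_le_mul' hI le_rfl).trans hBB)).trans ih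

/-- A two-sided ideal comaximal with `I` is comaximal with the powers of `I`. -/
theorem le_sup_pow_of_le_sup (hBB : B * B = B) {M : Submodule R L} (hI : I ≤ B)
    (hM : M * B ≤ M) (hM' : B * M ≤ M) (hMB : M ≤ B) (h : B ≤ M ⊔ I) (k : ℕ) :
    B ≤ M ⊔ I ^ k * B := by
  induction k with
  | zero => simp
  | succ k ih =>
    calc B = B * B := hBB.symm
      _ ≤ (M ⊔ I) * (M ⊔ I ^ k * B) := mul_le_mul' h ih
      _ ≤ M ⊔ I ^ (k + 1) * B := by
        rw [Submodule.sup_mul, Submodule.mul_sup I, ← mul_assoc I, ← pow_succ']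
        exact sup_le (((mul_le_mul' le_rfl
            (sup_le hMB (pow_mul_le hBB.le hI k))).trans hM).trans le_sup_left)
          (sup_le (((mul_le_mul' hI le_rfl).trans hM').trans le_sup_left) le_sup_right)

/-- A maximal two-sided ideal `I` of `B` is invertible if `B` is the left and the right order of
each of its two-sided ideals containing a power of the central unit that spans `ρ`.

A shortest product of copies of `I` and of a comaximal ideal `X` that lies in `ρ * B` has the form
`P * I * Q` with `Q * P` not contained in `ρ * B`; then `ρ⁻¹ * Q * P` shows that the inverse of `I`
is larger than `B`. -/
theorem exists_isInverseIdeal {X ρ ρ' : Submodule R L} (h1 : 1 ≤ B) (hBB : B * B = B)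
    (hρ : ρ * ρ' = 1) (hcomm : ∀ N, ρ * N = N * ρ) (hcomm' : ∀ N, ρ' * N = N * ρ')
    (hBI : B * I = I) (hIB : I * B = I) (hI : I ≤ B) (hX : X ≤ B)
    (hρI : ρ ≤ I) (hρX : ρ ≤ X) (hne : ¬ B ≤ I) (hXI : B ≤ X ⊔ I)
    (hnil : ∃ k, (X * I) ^ k ≤ ρ * B)
    (hmax : ∀ M : Submodule R L, B * M ≤ M → M * B ≤ M → M ≤ B → I ≤ M → ¬ M ≤ I → B ≤ M)
    (hleft : ∀ Z : Submodule R L, B * Z ≤ Z → Z * B ≤ Z → Z ≤ B → (∃ j, ρ ^ j ≤ Z) →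
      ∀ W, W * Z ≤ Z → W ≤ B)
    (hright : ∀ Z : Submodule R L, B * Z ≤ Z → Z * B ≤ Z → Z ≤ B → (∃ j, ρ ^ j ≤ Z) →
      ∀ W, Z * W ≤ Z → W ≤ B) :
    ∃ Y, IsInverseIdeal B I Y := by
  classical
  have hleB : ∀ N : Submodule R L, N ≤ B * N := fun N => by simpa using mul_le_mul' h1 (le_refl N)
  have hleB' : ∀ N : Submodule R L, N ≤ N * B := fun N => by simpa using mul_le_mul' (le_refl N) h1
  have hρ' : ρ' * ρ = 1 := by rw [← hcomm, hρ]
  have hex : ∃ n, ∃ l : List (Submodule R L), l.length = n ∧ (∀ Z ∈ l, Z = I ∨ Z = X) ∧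
      l.prod ≤ ρ * B := by
    obtain ⟨k, hk⟩ := hnil
    suffices ∀ k, ∃ l : List (Submodule R L), (∀ Z ∈ l, Z = I ∨ Z = X) ∧ l.prod = (X * I) ^ k by
      obtain ⟨l, hl, hl'⟩ := this k
      exact ⟨_, l, rfl, hl, hl'.trans_le hk⟩
    intro k
    induction k with
    | zero => exact ⟨[], by simp, by simp⟩
    | succ k ih =>
      obtain ⟨l, hl, hl'⟩ := ih
      refine ⟨X :: I :: l, ?_, by simp [hl', pow_succ', mul_assoc]⟩
      simpa using hl
  obtain ⟨l, hlen, hl, hlρ⟩ := Nat.find_spec hex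
  have hmin := fun j (hj : j < Nat.find hex) => Nat.find_min hex hj
  rw [← hlen] at hmin
  have hρBI : ρ * B ≤ I := (mul_le_mul' hρI le_rfl).trans hIB.le
  have hmem : I ∈ l := by
    by_contra hIl
    have : l.prod = X ^ l.length :=
      List.prod_eq_pow_card _ _ fun Z hZ => (hl Z hZ).resolve_left fun h => hIl (h ▸ hZ)
    rw [this] at hlρ
    have := le_sup_pow_of_le_sup hBB hX hIB.le hBI.le hI (sup_comm X I ▸ hXI) l.length
    exact hne (this.trans (sup_le le_rfl ((mul_le_mul' (hlρ.trans hρBI) le_rfl).trans hIB.le)))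
  obtain ⟨s, t, rfl⟩ := List.append_of_mem hmem
  have hprod_le : ∀ w : List (Submodule R L), (∀ Z ∈ w, Z = I ∨ Z = X) → w.prod ≤ B := by
    intro w hw
    induction w with
    | nil => simpa using h1
    | cons Z w ih =>
      rw [List.prod_cons, ← hBB]
      refine mul_le_mul' ?_ (ih fun Z hZ => hw Z (List.mem_cons_of_mem _ hZ))
      rcases hw Z List.mem_cons_self with rfl | rfl <;> assumption
  have hle_prod : ∀ w : List (Submodule R L), (∀ Z ∈ w, Z = I ∨ Z = X) →
      ρ ^ w.length ≤ w.prod := by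
    intro w hw
    induction w with
    | nil => simp
    | cons Z w ih =>
      rw [List.prod_cons, List.length_cons, pow_succ']
      refine mul_le_mul' ?_ (ih fun Z hZ => hw Z (List.mem_cons_of_mem _ hZ))
      rcases hw Z List.mem_cons_self with rfl | rfl <;> assumption
  have hs : ∀ Z ∈ s, Z = I ∨ Z = X := fun Z hZ => hl Z (by simp [hZ])
  have ht : ∀ Z ∈ t, Z = I ∨ Z = X := fun Z hZ => hl Z (by simp [hZ])
  rw [List.prod_append, List.prod_cons] at hlρ
  set P := B * s.prod * B with hP
  set Q := B * t.prod * B with hQ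
  have hPB : P ≤ B := by
    calc P ≤ B * B * B := mul_le_mul' (mul_le_mul' le_rfl (hprod_le s hs)) le_rfl
      _ = B := by rw [hBB, hBB]
  have hBP : B * P = P := by rw [hP, ← mul_assoc, ← mul_assoc, hBB]
  have hPB' : P * B = P := by rw [hP, mul_assoc, hBB]
  have hPIQ : P * I * Q ≤ ρ * B := by
    calc P * I * Q = B * (s.prod * (B * I * B * t.prod)) * B := by simp only [hP, hQ, mul_assoc]
      _ = B * (s.prod * (I * t.prod)) * B := by rw [hBI, hIB]
      _ ≤ B * (ρ * B) * B := mul_le_mul' (mul_le_mul' le_rfl hlρ) le_rfl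
      _ = ρ * B := by rw [← mul_assoc, ← hcomm, mul_assoc ρ, hBB, mul_assoc, hBB]
  have hQP : ¬ Q * P ≤ ρ * B := by
    intro h
    refine hmin (t ++ s).length (by simp; omega)
      ⟨t ++ s, rfl, fun Z hZ => (List.mem_append.1 hZ).elim (ht Z) (hs Z), le_trans ?_ h⟩
    rw [List.prod_append]
    exact mul_le_mul' ((hleB _).trans (hleB' _)) ((hleB _).trans (hleB' _))
  -- the inverse of `I`
  let Y : Submodule R L :=
    { carrier := {y | ∀ i ∈ I, i * y ∈ B}
      add_mem' := fun {x y} hx hy i hi => by rw [mul_add]; exact B.add_mem (hx i hi) (hy i hi)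
      zero_mem' := fun i _ => by simp
      smul_mem' := fun c x hx i hi => by rw [mul_smul_comm]; exact B.smul_mem c (hx i hi) }
  have hleY : ∀ W : Submodule R L, I * W ≤ B → W ≤ Y := fun W hW w hw i hi =>
    hW (Submodule.mul_mem_mul hi hw)
  have hIY : I * Y ≤ B := Submodule.mul_le.2 fun i hi y hy => hy i hi
  have hY1 : ¬ Y ≤ B := by
    intro hYB
    have : ρ' * (Q * P) ≤ B := by
      refine (hleY _ (hright P hBP.le hPB'.le hPB ⟨s.length, ?_⟩ _ ?_)).trans hYB
      · exact (hle_prod s hs).trans ((hleB _).trans (hleB' _))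
      · calc P * (I * (ρ' * (Q * P))) = ρ' * (P * I * Q) * P := by
              rw [← mul_assoc I, ← hcomm', ← mul_assoc P, ← mul_assoc P, ← hcomm']
              simp only [mul_assoc]
          _ ≤ ρ' * (ρ * B) * P := mul_le_mul' (mul_le_mul' le_rfl hPIQ) le_rfl
          _ = P := by rw [← mul_assoc ρ', hρ', one_mul, hBP]
    refine hQP ?_
    calc Q * P = ρ * (ρ' * (Q * P)) := by rw [← mul_assoc ρ, hρ, one_mul]
      _ ≤ ρ * B := mul_le_mul' le_rfl this
  have hBY : B * Y = Y := le_antisymm (hleY _ (by rwa [← mul_assoc, hIB])) (hleB _)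
  have hYB : Y * B = Y := le_antisymm
    (hleY _ (by rw [← mul_assoc, ← hBB]; exact mul_le_mul' hIY hBB.le)) (hleB' _)
  have h1Y : 1 ≤ Y := hleY _ (by rwa [mul_one])
  have hIρ : ∃ j, ρ ^ j ≤ I := ⟨1, by rwa [pow_one]⟩
  have e1 : I * Y = B := by
    refine le_antisymm hIY (hmax _ ?_ ?_ hIY ?_ fun h =>
      hY1 (hright I hBI.le hIB.le hI hIρ Y h))
    · rw [← mul_assoc, hBI]
    · rw [mul_assoc, hYB]
    · simpa using mul_le_mul' (le_refl I) h1Y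
  have hYI : Y * I ≤ B := hright I hBI.le hIB.le hI hIρ _ (by rw [← mul_assoc, e1, hBI])
  have e2 : Y * I = B := by
    refine le_antisymm hYI (hmax _ ?_ ?_ hYI ?_ fun h =>
      hY1 (hleft I hBI.le hIB.le hI hIρ Y h))
    · rw [← mul_assoc, hBY]
    · rw [mul_assoc, hIB]
    · simpa using mul_le_mul' h1Y (le_refl I)
  exact ⟨Y, e1, e2, hBI, hIB, hBY, hYB, hI⟩

end Ideals

/-! ### Powers of an ideal modulo a central element -/

section CentralElement

variable {R L : Type*} [CommRing R] [Ring L] [Algebra R L]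

variable (L) in
/-- The `R`-submodule of `L` spanned by the image of `r`, so that `scalarSpan L r * N = r N`. -/
def scalarSpan (r : R) : Submodule R L := Submodule.span R {algebraMap R L r}

theorem mem_scalarSpan_mul {r : R} {N : Submodule R L} {y : L} :
    y ∈ scalarSpan L r * N ↔ ∃ n ∈ N, r • n = y := by
  simp [scalarSpan, Submodule.mem_span_singleton_mul, Algebra.smul_def]

theorem scalarSpan_mul_comm (r : R) (N : Submodule R L) :
    scalarSpan L r * N = N * scalarSpan L r := by
  ext y
  simp only [scalarSpan, Submodule.mem_span_singleton_mul, Submodule.mem_mul_span_singleton]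
  simp only [Algebra.commutes]

theorem scalarSpan_pow (r : R) (j : ℕ) : scalarSpan L r ^ j = scalarSpan L (r ^ j) := by
  rw [scalarSpan, scalarSpan, Submodule.span_pow, Set.singleton_pow, map_pow]

theorem scalarSpan_mul_eq_smul (r : R) (N : Submodule R L) :
    scalarSpan L r * N = Ideal.span {r} • N := by
  ext y
  rw [mem_scalarSpan_mul, Submodule.ideal_span_singleton_smul,
    Submodule.mem_smul_pointwise_iff_exists]

end CentralElement

/-- By the Artin–Rees lemma for the commutator map, an element that is central modulo a high power
of `r` is congruent to a central element modulo `r`. -/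
theorem exists_center_add_smul {R B : Type*} [CommRing R] [IsNoetherianRing R] [Ring B]
    [Algebra R B] [Module.Finite R B] (r : R) :
    ∃ c : ℕ, ∀ u : B, (∀ b, ∃ d, u * b - b * u = r ^ c • d) →
      ∃ z b' : B, (∀ b, z * b = b * z) ∧ u = z + r • b' := by
  obtain ⟨s, hs⟩ := (Module.finite_def (R := R) (M := B)).1 inferInstance
  let δ : B →ₗ[R] (s → B) := LinearMap.pi fun i =>
    LinearMap.mulRight R (i : B) - LinearMap.mulLeft R (i : B)
  obtain ⟨k, hk⟩ := Ideal.exists_pow_inf_eq_pow_smul (Ideal.span {r}) (LinearMap.range δ)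
  refine ⟨k + 1, fun u hu => ?_⟩
  choose d hd using hu
  have hδ : δ u ∈ Ideal.span {r} ^ (k + 1) • (⊤ : Submodule R (s → B)) ⊓ LinearMap.range δ := by
    refine ⟨?_, LinearMap.mem_range_self _ _⟩
    rw [Ideal.span_singleton_pow, Submodule.ideal_span_singleton_smul,
      SetLike.mem_coe, Submodule.mem_smul_pointwise_iff_exists]
    refine ⟨fun i => d i, Submodule.mem_top, ?_⟩
    funext i
    simp [δ, ← hd]
  rw [hk _ (Nat.le_succ k), Nat.succ_sub (le_refl k), Nat.sub_self, pow_one,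
    Submodule.ideal_span_singleton_smul, Submodule.mem_smul_pointwise_iff_exists] at hδ
  obtain ⟨_, ⟨-, b', rfl⟩, hb'⟩ := hδ
  refine ⟨u - r • b', b', fun b => ?_, by simp⟩
  have hz : δ (u - r • b') = 0 := by rw [map_sub, map_smul, hb', sub_self]
  have hb : b ∈ Submodule.span R (s : Set B) := hs ▸ Submodule.mem_top
  induction hb using Submodule.span_induction with
  | mem x hx =>
    have := congrFun hz ⟨x, hx⟩
    simp only [δ, LinearMap.pi_apply, LinearMap.sub_apply, LinearMap.mulRight_apply,
      LinearMap.mulLeft_apply, Pi.zero_apply] at this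
    exact sub_eq_zero.1 this
  | zero => simp
  | add x y _ _ hx hy => rw [mul_add, add_mul, hx, hy]
  | smul c x _ hx => rw [mul_smul_comm, smul_mul_assoc, hx]

section SubalgebraFiltration

variable {R L : Type*} [CommRing R] [Ring L] [Algebra R L]

/-- The descending chain `I ^ k` is stationary modulo an `R`-submodule of finite colength. -/
theorem exists_pow_le_pow_sup (B : Subalgebra R L) (hB : (Subalgebra.toSubmodule B).FG)
    (r : R) [IsArtinian R (R ⧸ Ideal.span {r})] {I : Submodule R L}
    (hI : I ≤ Subalgebra.toSubmodule B) (hIB : I * Subalgebra.toSubmodule B = I) :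
    ∃ k, I ^ (k + 1) ≤ I ^ (2 * (k + 1)) ⊔ scalarSpan L r * Subalgebra.toSubmodule B := by
  have : Module.Finite R B := Module.Finite.iff_fg.2 hB
  have hpow : ∀ k, I ^ (k + 1) ≤ Subalgebra.toSubmodule B := fun k => by
    have := pow_mul_le (Subalgebra.isIdempotentElem_toSubmodule B).le hI (k + 1)
    rwa [pow_succ, mul_assoc, hIB, ← pow_succ] at this
  let N : Submodule R B := Ideal.span {r} • ⊤
  have := isArtinian_quotient_of_smul_top_le (Ideal.span {r}) N le_rfl
  have hanti : ∀ k l, k ≤ l → I ^ (l + 1) ≤ I ^ (k + 1) := by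
    intro k l hkl
    induction l, hkl using Nat.le_induction with
    | base => exact le_rfl
    | succ l _ ih =>
      refine le_trans ?_ ih
      rw [pow_succ I (l + 1)]
      refine (mul_le_mul' le_rfl hI).trans ?_
      rw [pow_succ, mul_assoc, hIB]
  let f : ℕ →o (Submodule R (B ⧸ N))ᵒᵈ :=
    ⟨fun k => OrderDual.toDual
      (((I ^ (k + 1)).comap (Subalgebra.toSubmodule B).subtype).map N.mkQ),
      fun k l hkl => Submodule.map_mono (Submodule.comap_mono (hanti k l hkl))⟩
  obtain ⟨k, hk⟩ := IsArtinian.monotone_stabilizes f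
  refine ⟨k, fun x hx => ?_⟩
  have hx' : N.mkQ ⟨x, hpow k hx⟩ ∈ OrderDual.ofDual (f k) := ⟨⟨x, hpow k hx⟩, hx, rfl⟩
  rw [hk (2 * k + 1) (by omega)] at hx'
  obtain ⟨y, hy, hxy⟩ := hx'
  have hN : (⟨x, hpow k hx⟩ : B) - y ∈ N := by
    rw [← Submodule.Quotient.eq]; exact hxy.symm
  have hN' : x - (y : L) ∈ scalarSpan L r * Subalgebra.toSubmodule B := by
    simp only [N, Submodule.ideal_span_singleton_smul,
      Submodule.mem_smul_pointwise_iff_exists] at hN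
    obtain ⟨b, -, hb⟩ := hN
    exact mem_scalarSpan_mul.2 ⟨b, b.2, congrArg Subtype.val hb⟩
  have := Submodule.add_mem_sup (show (y : L) ∈ I ^ (2 * (k + 1)) from hy) hN'
  rwa [add_sub_cancel] at this

/-- If the centre of `B` is a local ring then every proper invertible ideal of `B` has a power
contained in `r B`: stabilising the powers of `I` modulo a power of `r` gives an idempotent that is
central modulo that power, hence congruent to `0` or `1` modulo `r`. -/
theorem IsInverseIdeal.exists_pow_le [IsNoetherianRing R] [IsLocalRing R] (B : Subalgebra R L)
    (hB : (Subalgebra.toSubmodule B).FG) (r : R)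
    (hart : ∀ j, IsArtinian R (R ⧸ Ideal.span {r ^ j}))
    (hcen : ∀ z ∈ B, (∀ b ∈ B, z * b = b * z) → ∃ t, algebraMap R L t = z)
    {I Y : Submodule R L} (h : IsInverseIdeal (Subalgebra.toSubmodule B) I Y)
    (hrI : algebraMap R L r ∈ I) (h1I : 1 ∉ I) :
    ∃ k, I ^ (k + 1) ≤ scalarSpan L r * Subalgebra.toSubmodule B := by
  have : Module.Finite R B := Module.Finite.iff_fg.2 hB
  obtain ⟨c, hc⟩ := exists_center_add_smul (B := B) r
  -- the exponent `c + 1` instead of `c` keeps the idempotent meaningful modulo `r` if `c = 0`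
  have hart' := hart (c + 1)
  obtain ⟨k, hk⟩ := exists_pow_le_pow_sup B hB (r ^ (c + 1)) h.le h.mul_right
  refine ⟨k, ?_⟩
  set 𝔹 := Subalgebra.toSubmodule B with h𝔹
  set ρ := scalarSpan L (r ^ (c + 1)) with hρ
  have hBB : 𝔹 * 𝔹 = 𝔹 := Subalgebra.isIdempotentElem_toSubmodule B
  have hdrop : ∀ N : Submodule R L, N ≤ 𝔹 → ρ * N ≤ scalarSpan L r * 𝔹 := by
    intro N hN y hy
    obtain ⟨n, hn, rfl⟩ := mem_scalarSpan_mul.1 hy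
    exact mem_scalarSpan_mul.2 ⟨r ^ c • n, 𝔹.smul_mem _ (hN hn), by rw [smul_smul, pow_succ']⟩
  have hIB : I ^ (k + 1) ≤ 𝔹 := by
    rw [← h.pow_mul_right]
    exact pow_mul_le hBB.le h.le _
  have hB1 : 𝔹 ≤ I ^ (k + 1) ⊔ ρ * Y ^ (k + 1) := by
    calc 𝔹 = I ^ (k + 1) * Y ^ (k + 1) := (h.pow_mul_inv_pow k).symm
      _ ≤ (I ^ (2 * (k + 1)) ⊔ ρ * 𝔹) * Y ^ (k + 1) := mul_le_mul' hk le_rfl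
      _ = I ^ (k + 1) ⊔ ρ * Y ^ (k + 1) := by
        rw [Submodule.sup_mul, two_mul, pow_add, mul_assoc, h.pow_mul_inv_pow, h.pow_mul_right,
          mul_assoc, h.inv_pow_mul_left]
  obtain ⟨u, hu, v, hv, huv⟩ := Submodule.mem_sup.1 (hB1 (show (1 : L) ∈ 𝔹 from B.one_mem))
  have hvu : v = 1 - u := eq_sub_of_add_eq' huv
  have hvI : ∀ x ∈ I ^ (k + 1), v * x ∈ ρ * 𝔹 := fun x hx => by
    rw [← h.inv_pow_mul_pow k, ← mul_assoc]
    exact Submodule.mul_mem_mul hv hx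
  have hIv : ∀ x ∈ I ^ (k + 1), x * v ∈ ρ * 𝔹 := fun x hx => by
    rw [← h.pow_mul_inv_pow k, ← mul_assoc, scalarSpan_mul_comm, mul_assoc]
    exact Submodule.mul_mem_mul hx hv
  have hcomm : ∀ b ∈ 𝔹, u * b - b * u ∈ ρ * 𝔹 := by
    intro b hb
    have : u * b - b * u = (u * b) * v - v * (b * u) := by
      rw [hvu]; noncomm_ring
    rw [this]
    refine Submodule.sub_mem _ (hIv _ ?_) (hvI _ ?_)
    · rw [← h.pow_mul_right]; exact Submodule.mul_mem_mul hu hb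
    · rw [← h.pow_mul_left]; exact Submodule.mul_mem_mul hb hu
  obtain ⟨z, b', hz, hzu⟩ := hc ⟨u, hIB hu⟩ fun b => by
    obtain ⟨d, hd, hd'⟩ := mem_scalarSpan_mul.1 (hcomm b b.2)
    refine ⟨r • ⟨d, hd⟩, Subtype.ext ?_⟩
    rw [smul_smul, ← pow_succ]
    exact hd'.symm
  obtain ⟨t, ht⟩ := hcen z z.2 fun b hb => congrArg Subtype.val (hz ⟨b, hb⟩)
  have hut : u = algebraMap R L t + r • (b' : L) := by rw [ht]; exact congrArg Subtype.val hzu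
  have hvB : v ∈ 𝔹 := by
    rw [hvu]; exact 𝔹.sub_mem B.one_mem (hIB hu)
  have huvr : u * v ∈ scalarSpan L r * 𝔹 := hdrop _ le_rfl (hIv u hu)
  have hvur : v * u ∈ scalarSpan L r * 𝔹 := hdrop _ le_rfl (hvI u hu)
  have hsmul : ∀ b ∈ 𝔹, r • b ∈ scalarSpan L r * 𝔹 := fun b hb => mem_scalarSpan_mul.2 ⟨b, hb, rfl⟩
  rcases IsLocalRing.isUnit_or_isUnit_one_sub_self t with ⟨t', h'⟩ | ⟨t', h'⟩
  · -- `u` is a unit modulo `r`, so `v` lies in `r B` and `1 ∈ I`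
    exfalso
    have e : t • v = u * v - r • ((b' : L) * v) := by
      rw [hut, add_mul, ← Algebra.smul_def, smul_mul_assoc, add_sub_cancel_right]
    have hv' : v ∈ scalarSpan L r * 𝔹 := by
      have : v = (↑t'⁻¹ : R) • t • v := by rw [smul_smul, ← h', Units.inv_mul, one_smul]
      rw [this, e]
      exact Submodule.smul_mem _ _ (Submodule.sub_mem _ huvr (hsmul _ (B.mul_mem b'.2 hvB)))
    refine h1I ?_
    rw [← huv]
    refine I.add_mem ?_ ?_
    · have : I ^ (k + 1) ≤ I := by
        calc I ^ (k + 1) = I * (I ^ k * 𝔹) := by rw [← mul_assoc, ← pow_succ', h.pow_mul_right]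
          _ ≤ I * 𝔹 := mul_le_mul' le_rfl (pow_mul_le hBB.le h.le k)
          _ = I := h.mul_right
      exact this hu
    · obtain ⟨n, hn, rfl⟩ := mem_scalarSpan_mul.1 hv'
      rw [Algebra.smul_def, ← h.mul_right]
      exact Submodule.mul_mem_mul hrI hn
  · -- `v` is a unit modulo `r`, so `u` lies in `r B`
    have e : (1 - t) • u = v * u + r • ((b' : L) * u) := by
      rw [sub_smul, one_smul, Algebra.smul_def, ← smul_mul_assoc, hvu,
        ← sub_eq_of_eq_add' hut]
      noncomm_ring
    have hu' : u ∈ scalarSpan L r * 𝔹 := by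
      have : u = (↑t'⁻¹ : R) • (1 - t) • u := by rw [smul_smul, ← h', Units.inv_mul, one_smul]
      rw [this, e]
      exact Submodule.smul_mem _ _
        (Submodule.add_mem _ hvur (hsmul _ (B.mul_mem b'.2 (hIB hu))))
    intro x hx
    rw [← mul_one x, ← huv, mul_add]
    refine Submodule.add_mem _ ?_ (hdrop _ le_rfl (hIv x hx))
    obtain ⟨n, hn, rfl⟩ := mem_scalarSpan_mul.1 hu'
    rw [mul_smul_comm]
    exact hsmul _ (B.mul_mem (hIB hx) hn)

/-- If conjugation by a unit `x` of a semisimple ring maps a finitely generated order into itself,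
then so does the inverse conjugation: a monic equation of the former is one of the latter. -/
theorem inv_mul_mul_mem_of_mul_mul_inv_mem [IsSemisimpleRing L] (B : Subalgebra R L)
    (hB : (Subalgebra.toSubmodule B).FG) {r : R} (hr : IsUnit (algebraMap R L r))
    (hden : ∀ z : L, ∃ k : ℕ, r ^ k • z ∈ B) (x : Lˣ) (hx : ∀ b ∈ B, ↑x * b * ↑x⁻¹ ∈ B)
    {b : L} (hb : b ∈ B) : ↑x⁻¹ * b * ↑x ∈ B := by
  have : Module.Finite R B := Module.Finite.iff_fg.2 hB
  have hxp : ∀ (j : ℕ), ∀ b ∈ B, ↑(x ^ j) * b * ↑(x ^ j)⁻¹ ∈ B := by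
    intro j
    induction j with
    | zero => simp
    | succ j ih =>
      intro b hb
      have := ih _ (hx b hb)
      rw [pow_succ]
      simpa [mul_assoc] using this
  let σ : Module.End R L := LinearMap.mulLeft R (x : L) ∘ₗ LinearMap.mulRight R (↑x⁻¹ : L)
  let τ : Module.End R B := σ.restrict (p := Subalgebra.toSubmodule B)
    (q := Subalgebra.toSubmodule B) fun b hb => by simpa [σ, mul_assoc] using hx b hb
  have hτ : ∀ (j : ℕ) (b : B), (((τ ^ j) b : B) : L) = ↑(x ^ j) * b * ↑(x ^ j)⁻¹ := by
    intro j
    induction j with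
    | zero => simp
    | succ j ih =>
      intro b
      have hb : ((τ b : B) : L) = ↑x * (↑b * ↑x⁻¹) := rfl
      rw [pow_succ, Module.End.mul_apply, ih, pow_succ, hb]
      simp [mul_assoc]
  obtain ⟨p, hp, hpτ⟩ := LinearMap.exists_monic_and_aeval_eq_zero R τ
  set d := p.natDegree with hd
  have hB0 : ∀ b ∈ B, ∑ j ∈ Finset.range (d + 1), p.coeff j • (↑(x ^ j) * b * ↑(x ^ j)⁻¹) = 0 := by
    intro b hb
    have := congrArg (fun f : Module.End R B => ((f ⟨b, hb⟩ : B) : L)) hpτ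
    simpa [Polynomial.aeval_eq_sum_range, LinearMap.sum_apply, hτ] using this
  have hL0 : ∀ z : L, ∑ j ∈ Finset.range (d + 1), (p.coeff j • ↑(x ^ j)) * z * ↑(x ^ j)⁻¹ = 0 := by
    intro z
    obtain ⟨k, hk⟩ := hden z
    have h0 := hB0 _ hk
    obtain ⟨w, hw⟩ := hr.pow k
    have : algebraMap R L (r ^ k) *
        ∑ j ∈ Finset.range (d + 1), (p.coeff j • ↑(x ^ j)) * z * ↑(x ^ j)⁻¹ = 0 := by
      rw [← h0, ← Algebra.smul_def, Finset.smul_sum]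
      refine Finset.sum_congr rfl fun j _ => ?_
      rw [mul_smul_comm, smul_mul_assoc, smul_mul_assoc, smul_mul_assoc, smul_comm]
    rw [map_pow, ← hw] at this
    exact (Units.mul_right_eq_zero w).1 this
  have hswap := sum_mul_mul_swap _ (fun j => p.coeff j • ((x ^ j : Lˣ) : L))
    (fun j => (((x ^ j)⁻¹ : Lˣ) : L)) hL0 (↑(x ^ d) * (↑x⁻¹ * b * ↑x) * ↑(x ^ d)⁻¹)
  rw [Finset.sum_range_succ, hd, hp.coeff_natDegree, one_smul, ← hd] at hswap
  have hlast : (↑(x ^ d)⁻¹ : L) * (↑(x ^ d) * (↑x⁻¹ * b * ↑x) * ↑(x ^ d)⁻¹) * ↑(x ^ d)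
      = ↑x⁻¹ * b * ↑x := by
    simp only [mul_assoc, Units.inv_mul_cancel_left, Units.inv_mul, mul_one]
  rw [hlast, add_comm] at hswap
  rw [eq_neg_of_add_eq_zero_left hswap]
  refine B.neg_mem (B.sum_mem fun j hj => ?_)
  obtain ⟨i, hi⟩ := Nat.exists_eq_add_of_lt (Finset.mem_range.1 hj)
  have e1 : (x ^ j)⁻¹ * x ^ d = x ^ i * x := by
    rw [hi, add_assoc, pow_add, inv_mul_cancel_left, pow_succ]
  have e2 : (x ^ d)⁻¹ * x ^ j = x⁻¹ * (x ^ i)⁻¹ := by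
    rw [← mul_inv_rev, ← e1, mul_inv_rev, inv_inv]
  have e1' := congrArg (Units.val) e1
  have e2' := congrArg (Units.val) e2
  simp only [Units.val_mul] at e1' e2'
  have : (↑(x ^ j)⁻¹ : L) * (↑(x ^ d) * (↑x⁻¹ * b * ↑x) * ↑(x ^ d)⁻¹) * (p.coeff j • ↑(x ^ j))
      = p.coeff j • (↑(x ^ i) * b * ↑(x ^ i)⁻¹) := by
    rw [mul_smul_comm]
    congr 1
    calc _ = (↑(x ^ j)⁻¹ * ↑(x ^ d)) * (↑x⁻¹ * b * ↑x) * (↑(x ^ d)⁻¹ * ↑(x ^ j)) := by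
          simp only [mul_assoc]
      _ = _ := by rw [e1', e2']; simp [mul_assoc]
  rw [this]
  exact B.smul_mem (hxp i b hb) _

/-- A two-sided ideal `I = B x` of an order in a semisimple ring is invertible: conjugation by the
unit `x` maps `B` onto itself, so `B x = x B`. -/
theorem exists_isInverseIdeal_of_forall_mem_iff [IsSemisimpleRing L] (B : Subalgebra R L)
    (hB : (Subalgebra.toSubmodule B).FG) {r : R} (hr : IsUnit (algebraMap R L r))
    (hden : ∀ z : L, ∃ k : ℕ, r ^ k • z ∈ B) {I : Submodule R L} {x : L} (hxB : x ∈ B)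
    (hI : ∀ y, y ∈ I ↔ ∃ b ∈ B, b * x = y) (hxI : ∀ b ∈ B, x * b ∈ I)
    (hrI : algebraMap R L r ∈ I) : ∃ Y, IsInverseIdeal (Subalgebra.toSubmodule B) I Y := by
  obtain ⟨c, -, hc⟩ := (hI _).1 hrI
  obtain ⟨w, hw⟩ := hr
  have h1 : (↑w⁻¹ * c) * x = 1 := by rw [mul_assoc, hc, ← hw, Units.inv_mul]
  obtain ⟨x, rfl⟩ : IsUnit x := IsUnit.of_mul_eq_one _ (mul_eq_one_symm h1)
  have hσ : ∀ b ∈ B, ↑x * b * ↑x⁻¹ ∈ B := by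
    intro b hb
    obtain ⟨b', hb', h⟩ := (hI _).1 (hxI b hb)
    rwa [← h, Units.mul_inv_cancel_right]
  have hσ' : ∀ b ∈ B, ↑x⁻¹ * b * ↑x ∈ B := fun b hb =>
    inv_mul_mul_mem_of_mul_mul_inv_mem B hB ⟨w, hw⟩ hden x hσ hb
  set 𝔹 := Subalgebra.toSubmodule B
  have hBB : 𝔹 * 𝔹 = 𝔹 := Subalgebra.isIdempotentElem_toSubmodule B
  let X := Submodule.span R {(x : L)}
  let X' := Submodule.span R {(↑x⁻¹ : L)}
  have hXX' : X * X' = 1 := by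
    simp only [X, X']
    rw [Submodule.span_mul_span, Set.singleton_mul_singleton, Units.mul_inv, Submodule.one_eq_span]
  have hX'X : X' * X = 1 := by
    simp only [X, X']
    rw [Submodule.span_mul_span, Set.singleton_mul_singleton, Units.inv_mul, Submodule.one_eq_span]
  have hIX : I = 𝔹 * X := by
    ext y
    rw [hI, Submodule.mem_mul_span_singleton]; rfl
  have hcomm : X * 𝔹 = 𝔹 * X := by
    ext y
    rw [Submodule.mem_mul_span_singleton, Submodule.mem_span_singleton_mul]
    constructor
    · rintro ⟨b, hb, rfl⟩
      exact ⟨_, hσ b hb, by simp [mul_assoc]⟩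
    · rintro ⟨b, hb, rfl⟩
      exact ⟨_, hσ' b hb, by simp [mul_assoc]⟩
  have hcomm' : X' * 𝔹 = 𝔹 * X' := by
    calc X' * 𝔹 = X' * (𝔹 * X) * X' := by rw [mul_assoc, mul_assoc, hXX', mul_one]
      _ = 𝔹 * X' := by rw [← hcomm, ← mul_assoc, hX'X, one_mul]
  refine ⟨𝔹 * X', ?_, ?_, ?_, ?_, ?_, ?_, ?_⟩
  · rw [hIX, ← hcomm', mul_assoc, ← mul_assoc X, hXX', one_mul, hBB]
  · rw [hIX, ← hcomm, mul_assoc, ← mul_assoc X', hX'X, one_mul, hBB]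
  · rw [hIX, ← mul_assoc, hBB]
  · rw [hIX, mul_assoc, hcomm, ← mul_assoc, hBB]
  · rw [← mul_assoc, hBB]
  · rw [mul_assoc, hcomm', ← mul_assoc, hBB]
  · intro y hy
    obtain ⟨b, hb, rfl⟩ := (hI y).1 hy
    exact B.mul_mem hb hxB

end SubalgebraFiltration

/-! ### Orders and localization -/

section Orders

variable {R L : Type*} [CommRing R] [Ring L] [Algebra R L]

theorem subalgebra_fg_of_smul_mem [IsNoetherianRing R] {B C : Subalgebra R L}
    (hB : (Subalgebra.toSubmodule B).FG) {r : R} (hr : IsUnit (algebraMap R L r))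
    (h : ∀ y ∈ C, r • y ∈ B) : (Subalgebra.toSubmodule C).FG := by
  have : Module.Finite R (Subalgebra.toSubmodule B) := Module.Finite.iff_fg.2 hB
  let g : C →ₗ[R] Subalgebra.toSubmodule B :=
    (LinearMap.lsmul R L r).restrict (p := Subalgebra.toSubmodule C) h
  have hg : Function.Injective g := by
    intro x y hxy
    have : r • (x : L) = r • (y : L) := congrArg Subtype.val hxy
    rw [Algebra.smul_def, Algebra.smul_def] at this
    exact Subtype.ext (hr.mul_left_cancel this)
  have : Module.Finite R C := Module.Finite.of_injective g hg
  exact Module.Finite.iff_fg.1 this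

/-- `B` has no proper finitely generated overring in `L`; for an order this is maximality. -/
def HasNoFiniteOverring (B : Subalgebra R L) : Prop :=
  ∀ C : Subalgebra R L, (Subalgebra.toSubmodule C).FG → B ≤ C → C = B

/-- An order with no proper finitely generated overring is the left order of each of its full
ideals. -/
theorem HasNoFiniteOverring.le_of_mul_le [IsNoetherianRing R] {B : Subalgebra R L}
    (hmax : HasNoFiniteOverring B)
    (hB : (Subalgebra.toSubmodule B).FG) {r : R} (hr : IsUnit (algebraMap R L r))
    {Z : Submodule R L} (hBZ : Subalgebra.toSubmodule B * Z ≤ Z)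
    (hZ : Z ≤ Subalgebra.toSubmodule B) {j : ℕ} (hj : scalarSpan L r ^ j ≤ Z)
    {W : Submodule R L} (hW : W * Z ≤ Z) : W ≤ Subalgebra.toSubmodule B := by
  let C : Subalgebra R L :=
    { carrier := {y | ∀ z ∈ Z, y * z ∈ Z}
      mul_mem' := fun {x y} hx hy z hz => by rw [mul_assoc]; exact hx _ (hy z hz)
      add_mem' := fun {x y} hx hy z hz => by rw [add_mul]; exact Z.add_mem (hx z hz) (hy z hz)
      algebraMap_mem' := fun c z hz => by rw [← Algebra.smul_def]; exact Z.smul_mem c hz }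
  have hrj : algebraMap R L (r ^ j) ∈ Z := hj (by
    rw [scalarSpan_pow]; exact Submodule.mem_span_singleton_self _)
  have hC : C = B := by
    refine hmax C (subalgebra_fg_of_smul_mem hB (r := r ^ j) (by rw [map_pow]; exact hr.pow j)
      fun y hy => ?_) fun b hb z hz => hBZ (Submodule.mul_mem_mul hb hz)
    rw [Algebra.smul_def, Algebra.commutes]
    exact hZ (hy _ hrj)
  intro w hw
  rw [← hC]
  exact fun z hz => hW (Submodule.mul_mem_mul hw hz)

theorem HasNoFiniteOverring.le_of_mul_le' [IsNoetherianRing R] {B : Subalgebra R L}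
    (hmax : HasNoFiniteOverring B)
    (hB : (Subalgebra.toSubmodule B).FG) {r : R} (hr : IsUnit (algebraMap R L r))
    {Z : Submodule R L} (hZB : Z * Subalgebra.toSubmodule B ≤ Z)
    (hZ : Z ≤ Subalgebra.toSubmodule B) {j : ℕ} (hj : scalarSpan L r ^ j ≤ Z)
    {W : Submodule R L} (hW : Z * W ≤ Z) : W ≤ Subalgebra.toSubmodule B := by
  let C : Subalgebra R L :=
    { carrier := {y | ∀ z ∈ Z, z * y ∈ Z}
      mul_mem' := fun {x y} hx hy z hz => by rw [← mul_assoc]; exact hy _ (hx z hz)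
      add_mem' := fun {x y} hx hy z hz => by rw [mul_add]; exact Z.add_mem (hx z hz) (hy z hz)
      algebraMap_mem' := fun c z hz => by
        rw [← Algebra.commutes, ← Algebra.smul_def]; exact Z.smul_mem c hz }
  have hrj : algebraMap R L (r ^ j) ∈ Z := hj (by
    rw [scalarSpan_pow]; exact Submodule.mem_span_singleton_self _)
  have hC : C = B := by
    refine hmax C (subalgebra_fg_of_smul_mem hB (r := r ^ j) (by rw [map_pow]; exact hr.pow j)
      fun y hy => ?_) fun b hb z hz => hZB (Submodule.mul_mem_mul hz hb)
    rw [Algebra.smul_def]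
    exact hZ (hy _ hrj)
  intro w hw
  rw [← hC]
  exact fun z hz => hW (Submodule.mul_mem_mul hz hw)

end Orders

section Localization

variable {R R' A L : Type*} [CommRing R] [CommRing R'] [Ring A] [Algebra R A]
  [Ring L] [Algebra R L] [Algebra R' L]

/-- The subalgebra `B` of `L` is the localization of `A` at the prime ideal `m` of `R`, via
`f : A → L`. -/
structure IsLocalizedSubalgebra (m : Ideal R) (f : A →ₐ[R] L) (B : Subalgebra R' L) : Prop where
  mem_iff : ∀ y, y ∈ B ↔ ∃ s ∉ m, ∃ a, s • y = f a
  exists_smul_eq_zero : ∀ a, f a = 0 → ∃ s ∉ m, s • a = 0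

variable (R') in
/-- The localization of an `R`-submodule of `A`, as an `R'`-submodule of `L`. -/
def localizedSubmodule (f : A →ₐ[R] L) (X : Submodule R A) : Submodule R' L :=
  Submodule.span R' (f '' X)

variable {f : A →ₐ[R] L} {B : Subalgebra R' L}

theorem localizedSubmodule_mono {X X' : Submodule R A} (h : X ≤ X') :
    localizedSubmodule R' f X ≤ localizedSubmodule R' f X' :=
  Submodule.span_mono (Set.image_mono h)

theorem apply_mem_localizedSubmodule {X : Submodule R A} {a : A} (ha : a ∈ X) :
    f a ∈ localizedSubmodule R' f X := Submodule.subset_span ⟨a, ha, rfl⟩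

theorem localizedSubmodule_sup (X X' : Submodule R A) :
    localizedSubmodule R' f (X ⊔ X') = localizedSubmodule R' f X ⊔ localizedSubmodule R' f X' := by
  refine le_antisymm (Submodule.span_le.2 ?_) (sup_le (localizedSubmodule_mono le_sup_left)
    (localizedSubmodule_mono le_sup_right))
  rintro _ ⟨a, ha, rfl⟩
  obtain ⟨x, hx, y, hy, rfl⟩ := Submodule.mem_sup.1 ha
  rw [map_add]
  exact Submodule.add_mem_sup (apply_mem_localizedSubmodule hx) (apply_mem_localizedSubmodule hy)

theorem localizedSubmodule_mul (X X' : Submodule R A) :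
    localizedSubmodule R' f (X * X') = localizedSubmodule R' f X * localizedSubmodule R' f X' := by
  refine le_antisymm (Submodule.span_le.2 ?_) ?_
  · rintro _ ⟨a, ha, rfl⟩
    induction ha using Submodule.mul_induction_on' with
    | mem_mul_mem x hx y hy =>
      rw [map_mul]
      exact Submodule.mul_mem_mul (apply_mem_localizedSubmodule hx)
        (apply_mem_localizedSubmodule hy)
    | add x _ y _ hx hy => rw [map_add]; exact Submodule.add_mem _ hx hy
  · rw [localizedSubmodule, localizedSubmodule, Submodule.span_mul_span, Submodule.span_le]
    rintro _ ⟨_, ⟨x, hx, rfl⟩, _, ⟨y, hy, rfl⟩, rfl⟩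
    change f x * f y ∈ _
    rw [← map_mul]
    exact apply_mem_localizedSubmodule (Submodule.mul_mem_mul hx hy)

theorem IsLocalizedSubalgebra.apply_mem {m : Ideal R} [m.IsPrime]
    (h : IsLocalizedSubalgebra m f B) (a : A) : f a ∈ B :=
  (h.mem_iff _).2 ⟨1, m.primeCompl.one_mem, a, one_smul _ _⟩

variable [Algebra R R'] [IsScalarTower R R' L]

theorem localizedSubmodule_one : localizedSubmodule R' f 1 = 1 := by
  rw [localizedSubmodule, Submodule.one_eq_span, Submodule.one_eq_span]
  refine le_antisymm (Submodule.span_le.2 ?_) (Submodule.span_le.2 ?_)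
  · rintro _ ⟨a, ha, rfl⟩
    obtain ⟨c, rfl⟩ := Submodule.mem_span_singleton.1 ha
    rw [map_smul, map_one, ← algebraMap_smul R' c (1 : L)]
    exact Submodule.smul_mem _ _ (Submodule.mem_span_singleton_self _)
  · rintro _ rfl
    exact Submodule.subset_span ⟨1, Submodule.mem_span_singleton_self _, map_one f⟩

theorem localizedSubmodule_pow (X : Submodule R A) (k : ℕ) :
    localizedSubmodule R' f (X ^ k) = localizedSubmodule R' f X ^ k := by
  induction k with
  | zero => simp [localizedSubmodule_one]
  | succ k ih => rw [pow_succ, pow_succ, localizedSubmodule_mul, ih]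


/-- Submodules over the localization are stable under division by elements outside `m`. -/
theorem mem_of_smul_mem_of_notMem {m : Ideal R} [m.IsPrime] [IsLocalization.AtPrime R' m]
    {N : Submodule R' L} {s : R} (hs : s ∉ m) {y : L} (h : s • y ∈ N) : y ∈ N := by
  obtain ⟨w, hw⟩ := IsLocalization.map_units R' (⟨s, hs⟩ : m.primeCompl)
  have : y = (↑w⁻¹ : R') • (s • y) := by
    rw [← algebraMap_smul R' s y, smul_smul,
      (show algebraMap R R' s = w from hw.symm), Units.inv_mul, one_smul]
  rw [this]
  exact N.smul_mem _ h

theorem mem_localizedSubmodule (m : Ideal R) [m.IsPrime] [IsLocalization.AtPrime R' m]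
    {X : Submodule R A} {y : L} :
    y ∈ localizedSubmodule R' f X ↔ ∃ s ∉ m, ∃ a ∈ X, s • y = f a := by
  constructor
  · intro hy
    induction hy using Submodule.span_induction with
    | mem y hy =>
      obtain ⟨a, ha, rfl⟩ := hy
      exact ⟨1, m.primeCompl.one_mem, a, ha, one_smul _ _⟩
    | zero => exact ⟨1, m.primeCompl.one_mem, 0, X.zero_mem, by simp⟩
    | add y z _ _ hy hz =>
      obtain ⟨s, hs, a, ha, hsa⟩ := hy
      obtain ⟨t, ht, b, hb, htb⟩ := hz
      refine ⟨s * t, m.primeCompl.mul_mem hs ht, t • a + s • b,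
        X.add_mem (X.smul_mem _ ha) (X.smul_mem _ hb), ?_⟩
      rw [smul_add, mul_comm, mul_smul, hsa, mul_comm, mul_smul, htb, map_add, map_smul, map_smul]
    | smul c y _ hy =>
      obtain ⟨s, hs, a, ha, hsa⟩ := hy
      obtain ⟨⟨b, t⟩, hbt⟩ := IsLocalization.surj m.primeCompl c
      refine ⟨s * t, m.primeCompl.mul_mem hs t.2, b • a, X.smul_mem _ ha, ?_⟩
      rw [mul_smul, ← algebraMap_smul R' (t : R) (c • y), smul_smul, mul_comm _ c, hbt,
        algebraMap_smul, smul_comm, hsa, map_smul]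
  · rintro ⟨s, hs, a, ha, hsa⟩
    exact mem_of_smul_mem_of_notMem hs (hsa ▸ apply_mem_localizedSubmodule ha)

/-- An element whose multiples by `m` lie in `X` is in `X` as soon as it is there locally. -/
theorem mem_of_smul_mem_of_isMaximal {M : Type*} [AddCommGroup M] [Module R M] {m : Ideal R}
    [hm : m.IsMaximal] {X : Submodule R M} {a : M} {s : R} (hs : s ∉ m) (ha : ∀ t ∈ m, t • a ∈ X)
    (h : s • a ∈ X) : a ∈ X := by
  obtain ⟨c, t, ht, hc⟩ := hm.exists_inv hs
  have : a = c • s • a + t • a := by rw [smul_smul, ← add_smul, hc, one_smul]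
  rw [this]
  exact X.add_mem (X.smul_mem _ h) (ha t ht)

namespace IsLocalizedSubalgebra

variable {m : Ideal R} [m.IsPrime] [IsLocalization.AtPrime R' m] (h : IsLocalizedSubalgebra m f B)

include h

theorem localizedSubmodule_top : localizedSubmodule R' f ⊤ = Subalgebra.toSubmodule B := by
  ext y
  rw [mem_localizedSubmodule m, Subalgebra.mem_toSubmodule, h.mem_iff]
  simp

theorem localizedSubmodule_le (X : Submodule R A) :
    localizedSubmodule R' f X ≤ Subalgebra.toSubmodule B := by
  rw [← h.localizedSubmodule_top]
  exact localizedSubmodule_mono le_top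

theorem exists_smul_mem {X : Submodule R A} {a : A} (ha : f a ∈ localizedSubmodule R' f X) :
    ∃ s ∉ m, s • a ∈ X := by
  obtain ⟨s, hs, x, hx, hsx⟩ := (mem_localizedSubmodule m).1 ha
  obtain ⟨t, ht, hta⟩ := h.exists_smul_eq_zero (s • a - x) (by
    rw [map_sub, map_smul, hsx, sub_self])
  refine ⟨t * s, m.primeCompl.mul_mem ht hs, ?_⟩
  rw [smul_sub, sub_eq_zero] at hta
  rw [mul_smul, hta]
  exact X.smul_mem _ hx

theorem mem_of_apply_mem [m.IsMaximal] {X : Submodule R A} {a : A}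
    (ha : f a ∈ localizedSubmodule R' f X) (hma : ∀ t ∈ m, t • a ∈ X) : a ∈ X := by
  obtain ⟨s, hs, hsa⟩ := h.exists_smul_mem ha
  exact mem_of_smul_mem_of_isMaximal hs hma hsa

/-- Each `R'`-submodule of `B` is the localization of its contraction to `A`. -/
theorem localizedSubmodule_comap {N : Submodule R' L} (hN : N ≤ Subalgebra.toSubmodule B) :
    localizedSubmodule R' f ((N.restrictScalars R).comap f.toLinearMap) = N := by
  refine le_antisymm (Submodule.span_le.2 ?_) fun y hy => ?_
  · rintro _ ⟨a, ha, rfl⟩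
    exact ha
  · obtain ⟨s, hs, a, hsa⟩ := (h.mem_iff y).1 (hN hy)
    refine (mem_localizedSubmodule m).2 ⟨s, hs, a, ?_, hsa⟩
    change f a ∈ N
    rw [← hsa, ← algebraMap_smul R' s y]
    exact N.smul_mem _ hy

end IsLocalizedSubalgebra

end Localization

/-! ### Orders over a local ring -/

section LocalOrders

variable {R L : Type*} [CommRing R] [IsLocalRing R] [Ring L] [Algebra R L]

/-- `B` is an order in `L` over the local ring `R` with centre (the image of) `R`; the denominators
are powers of an element `r` of the maximal ideal for which each `R / r ^ j` is Artinian. -/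
structure IsLocalOrder (B : Subalgebra R L) (r : R) : Prop where
  fg : (Subalgebra.toSubmodule B).FG
  isUnit : IsUnit (algebraMap R L r)
  mem_maximalIdeal : r ∈ IsLocalRing.maximalIdeal R
  exists_pow_smul_mem : ∀ z : L, ∃ k : ℕ, r ^ k • z ∈ B
  isArtinian : ∀ j, IsArtinian R (R ⧸ Ideal.span {r ^ j})
  exists_pow_le : ∃ j, IsLocalRing.maximalIdeal R ^ j ≤ Ideal.span {r}
  exists_algebraMap_eq : ∀ z ∈ B, (∀ b ∈ B, z * b = b * z) → ∃ t, algebraMap R L t = z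

variable {B : Subalgebra R L} {r : R}

theorem IsLocalOrder.exists_pow_mul_le (h : IsLocalOrder B r) {C : Submodule R L} (hC : C.FG) :
    ∃ n, scalarSpan L r ^ n * C ≤ Subalgebra.toSubmodule B := by
  suffices ∃ n : ℕ, ∀ c ∈ C, r ^ n • c ∈ B by
    obtain ⟨n, hn⟩ := this
    refine ⟨n, fun y hy => ?_⟩
    rw [scalarSpan_pow] at hy
    obtain ⟨c, hc, rfl⟩ := mem_scalarSpan_mul.1 hy
    exact hn c hc
  induction C, hC using Submodule.fg_induction with
  | singleton x =>
    obtain ⟨k, hk⟩ := h.exists_pow_smul_mem x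
    refine ⟨k, fun c hc => ?_⟩
    obtain ⟨a, rfl⟩ := Submodule.mem_span_singleton.1 hc
    rw [smul_comm]
    exact B.smul_mem hk a
  | sup C C' _ _ hC hC' =>
    obtain ⟨n, hn⟩ := hC
    obtain ⟨n', hn'⟩ := hC'
    refine ⟨n + n', fun c hc => ?_⟩
    obtain ⟨x, hx, y, hy, rfl⟩ := Submodule.mem_sup.1 hc
    rw [smul_add]
    refine B.add_mem ?_ ?_
    · rw [add_comm n, pow_add, mul_smul]; exact B.smul_mem (hn x hx) _
    · rw [pow_add, mul_smul]; exact B.smul_mem (hn' y hy) _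

/-- If an ideal that is maximal among the two-sided ideals is invertible, then the order has no
proper overring. -/
theorem IsLocalOrder.hasNoFiniteOverring [IsNoetherianRing R] (h : IsLocalOrder B r)
    {I Y : Submodule R L} (hY : IsInverseIdeal (Subalgebra.toSubmodule B) I Y)
    (hrI : algebraMap R L r ∈ I) (h1I : 1 ∉ I)
    (hmax : ∀ M : Submodule R L, Subalgebra.toSubmodule B * M ≤ M →
      M * Subalgebra.toSubmodule B ≤ M → M ≤ Subalgebra.toSubmodule B → ¬ M ≤ I →
      Subalgebra.toSubmodule B ≤ M ⊔ I) : HasNoFiniteOverring B := by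
  intro C hC hBC
  obtain ⟨k, hk⟩ := hY.exists_pow_le B h.fg r h.isArtinian h.exists_algebraMap_eq hrI h1I
  have hBB := Subalgebra.isIdempotentElem_toSubmodule B
  have hCC := Subalgebra.isIdempotentElem_toSubmodule C
  set 𝔹 := Subalgebra.toSubmodule B
  refine le_antisymm (hY.overring_le (Submodule.one_le.2 B.one_mem)
    (C := Subalgebra.toSubmodule C) hBC hCC.le ?_ ?_) hBC
  · obtain ⟨n, hn⟩ := h.exists_pow_mul_le hC
    refine ⟨(k + 1) * n, ?_⟩
    calc I ^ ((k + 1) * n) * Subalgebra.toSubmodule C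
        ≤ (scalarSpan L r * 𝔹) ^ n * Subalgebra.toSubmodule C := by
          rw [pow_mul]; exact mul_le_mul' (pow_le_pow_left' hk n) le_rfl
      _ = scalarSpan L r ^ n * (𝔹 ^ n * Subalgebra.toSubmodule C) := by
          rw [Commute.mul_pow (scalarSpan_mul_comm r 𝔹), mul_assoc]
      _ ≤ scalarSpan L r ^ n * Subalgebra.toSubmodule C :=
          mul_le_mul' le_rfl (pow_mul_le hCC.le hBC n)
      _ ≤ 𝔹 := hn
  · intro M h1 h2 h3 h4
    have := le_sup_pow_of_le_sup hBB hY.le h2 h1 h3 (hmax M h1 h2 h3 h4) (k + 1)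
    rw [hY.pow_mul_right] at this
    refine Submodule.le_of_le_smul_of_le_jacobson_bot (I := Ideal.span {r}) h.fg ?_
      (this.trans (sup_le_sup le_rfl (hk.trans_eq (scalarSpan_mul_eq_smul r 𝔹))))
    rw [Ideal.span_singleton_le_iff_mem, IsLocalRing.jacobson_eq_maximalIdeal _ bot_ne_top]
    exact h.mem_maximalIdeal

theorem IsLocalOrder.exists_isInverseIdeal [IsNoetherianRing R] (h : IsLocalOrder B r)
    (hmaxB : HasNoFiniteOverring B) {I X : Submodule R L}
    (hBI : Subalgebra.toSubmodule B * I = I) (hIB : I * Subalgebra.toSubmodule B = I)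
    (hI : I ≤ Subalgebra.toSubmodule B) (hX : X ≤ Subalgebra.toSubmodule B)
    (hrI : algebraMap R L r ∈ I) (hrX : algebraMap R L r ∈ X)
    (h1I : 1 ∉ I) (hXI : Subalgebra.toSubmodule B ≤ X ⊔ I)
    (hnil : ∃ k, (X * I) ^ k ≤ scalarSpan L r * Subalgebra.toSubmodule B)
    (hmax : ∀ M : Submodule R L, Subalgebra.toSubmodule B * M ≤ M →
      M * Subalgebra.toSubmodule B ≤ M → M ≤ Subalgebra.toSubmodule B → ¬ M ≤ I →
      Subalgebra.toSubmodule B ≤ M ⊔ I) :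
    ∃ Y, IsInverseIdeal (Subalgebra.toSubmodule B) I Y := by
  obtain ⟨w, hw⟩ := h.isUnit
  have hρ : scalarSpan L r * Submodule.span R {(↑w⁻¹ : L)} = 1 := by
    rw [scalarSpan, ← hw, Submodule.span_mul_span, Set.singleton_mul_singleton, Units.mul_inv,
      Submodule.one_eq_span]
  have hw' : ∀ y : L, ↑w⁻¹ * y = y * ↑w⁻¹ := fun y => by
    rw [Units.inv_mul_eq_iff_eq_mul, ← mul_assoc, hw, Algebra.commutes, ← hw,
      Units.mul_inv_cancel_right]
  refine _root_.exists_isInverseIdeal (ρ := scalarSpan L r) (Submodule.one_le.2 B.one_mem)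
    (Subalgebra.isIdempotentElem_toSubmodule B) hρ (scalarSpan_mul_comm r) (fun N => ?_)
    hBI hIB hI hX ?_ ?_ (fun hle => h1I (hle B.one_mem)) hXI hnil
    (fun M h1 h2 h3 hIM h4 => (hmax M h1 h2 h3 h4).trans (sup_le le_rfl hIM))
    (fun Z h1 _ h3 ⟨j, hj⟩ W hW => hmaxB.le_of_mul_le h.fg h.isUnit h1 h3 hj hW)
    (fun Z _ h2 h3 ⟨j, hj⟩ W hW => hmaxB.le_of_mul_le' h.fg h.isUnit h2 h3 hj hW)
  · ext y
    rw [Submodule.mem_span_singleton_mul, Submodule.mem_mul_span_singleton]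
    simp only [hw']
  · rwa [scalarSpan, Submodule.span_singleton_le_iff_mem]
  · rwa [scalarSpan, Submodule.span_singleton_le_iff_mem]

end LocalOrders

/-! ### Simple modules over finite algebras -/

section SimpleModules

variable (R : Type*) {A : Type*} [CommRing R] [Ring A] [Algebra R A] [Module.Finite R A]
  (S : Type*) [AddCommGroup S] [Module A S] [IsSimpleModule A S]

variable {S} (A) in
theorem exists_smul_eq_of_ne_zero {s : S} (hs : s ≠ 0) (t : S) : ∃ a : A, a • s = t :=
  IsSimpleModule.toSpanSingleton_surjective A hs t

include R in
theorem isSemisimpleModule_quotient_annihilator :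
    IsSemisimpleModule A (A ⧸ Module.annihilator A S) := by
  have := IsSimpleModule.nontrivial A S
  obtain ⟨s, hs⟩ := exists_ne (0 : S)
  obtain ⟨n, g, hg⟩ := Module.Finite.exists_fin' R A
  -- an element killing the images `g(eᵢ) s` of `R`-module generators annihilates `S`
  let φ : A →ₗ[A] (Fin n → S) :=
    LinearMap.pi fun i => LinearMap.toSpanSingleton A S (g (Pi.single i 1) • s)
  have hφ : LinearMap.ker φ = Module.annihilator A S := by
    ext a
    rw [LinearMap.mem_ker, Module.mem_annihilator]
    refine ⟨fun h t => ?_, fun h => funext fun i => h _⟩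
    obtain ⟨b, rfl⟩ := exists_smul_eq_of_ne_zero A hs t
    obtain ⟨c, rfl⟩ := hg b
    have hc : c = ∑ i, c i • Pi.single i (1 : R) := by
      ext j; simp [Finset.sum_apply, Pi.single_apply]
    have h' : ∀ i, a • g (Pi.single i 1) • s = 0 := fun i => congrFun h i
    simp only [smul_smul] at h' ⊢
    rw [hc, map_sum, Finset.mul_sum, Finset.sum_smul]
    refine Finset.sum_eq_zero fun i _ => ?_
    rw [map_smul, Algebra.smul_def, ← mul_assoc, ← Algebra.commutes, mul_assoc, mul_smul, h',
      smul_zero]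
  rw [← hφ]
  exact IsSemisimpleModule.congr φ.quotKerEquivRange

theorem isIsotypicOfType_quotient_annihilator :
    IsIsotypicOfType A (A ⧸ Module.annihilator A S) S := by
  intro N hN
  have := IsSimpleModule.nontrivial A N
  obtain ⟨⟨x, hxN⟩, hx⟩ := exists_ne (0 : N)
  obtain ⟨a, rfl⟩ := Submodule.mkQ_surjective _ x
  have ha : a ∉ Module.annihilator A S := fun h => hx (Subtype.ext
    ((Submodule.Quotient.mk_eq_zero _).2 h))
  rw [Module.mem_annihilator] at ha
  push Not at ha
  obtain ⟨s, hs⟩ := ha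
  let φ : (A ⧸ Module.annihilator A S) →ₗ[A] S :=
    Submodule.liftQ _ (LinearMap.toSpanSingleton A S s) fun b hb =>
      Module.mem_annihilator.1 hb s
  have hne : φ ∘ₗ N.subtype ≠ 0 := fun h => hs (LinearMap.congr_fun h ⟨_, hxN⟩)
  exact ⟨LinearEquiv.ofBijective _ (LinearMap.bijective_of_ne_zero hne)⟩

include R in
theorem exists_linearEquiv_quotient_annihilator :
    ∃ n : ℕ, Nonempty ((A ⧸ Module.annihilator A S) ≃ₗ[A] (Fin n → S)) :=
  have := isSemisimpleModule_quotient_annihilator R (A := A) S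
  (isIsotypicOfType_quotient_annihilator S).linearEquiv_fun

include R in
/-- A simple module killed by the annihilator of the simple module `S` is isomorphic to `S`. -/
theorem nonempty_linearEquiv_of_annihilator_smul {T : Type*} [AddCommGroup T] [Module A T]
    [IsSimpleModule A T] (hT : ∀ a ∈ Module.annihilator A S, ∀ t : T, a • t = 0) :
    Nonempty (T ≃ₗ[A] S) := by
  have := IsSimpleModule.nontrivial A T
  obtain ⟨t, ht⟩ := exists_ne (0 : T)
  obtain ⟨n, ⟨e⟩⟩ := exists_linearEquiv_quotient_annihilator R (A := A) S
  let φ : (A ⧸ Module.annihilator A S) →ₗ[A] T :=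
    Submodule.liftQ _ (LinearMap.toSpanSingleton A T t) fun b hb => hT b hb t
  have hφ : φ ∘ₗ e.symm.toLinearMap ≠ 0 := by
    intro h
    have h0 := LinearMap.congr_fun h (e (Submodule.Quotient.mk 1))
    have h1 : φ (Submodule.Quotient.mk 1) = t := one_smul A t
    rw [LinearMap.comp_apply, LinearEquiv.coe_coe, LinearEquiv.symm_apply_apply, h1] at h0
    exact ht h0
  by_contra hTS
  refine hφ (LinearMap.pi_ext' fun i => ?_)
  by_contra h
  exact hTS ⟨(LinearEquiv.ofBijective _ (LinearMap.bijective_of_ne_zero h)).symm⟩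

include R in
theorem exists_linearEquiv_fun_of_annihilator_smul {M : Type*} [AddCommGroup M] [Module A M]
    [Module.Finite A M] (hM : ∀ a ∈ Module.annihilator A S, ∀ x : M, a • x = 0) :
    ∃ n : ℕ, Nonempty (M ≃ₗ[A] (Fin n → S)) := by
  have := isSemisimpleModule_quotient_annihilator R (A := A) S
  let φ : M → (A ⧸ Module.annihilator A S) →ₗ[A] M := fun x =>
    Submodule.liftQ _ (LinearMap.toSpanSingleton A M x) fun b hb => hM b hb x
  have : IsSemisimpleModule A M := by
    refine isSemisimpleModule_of_isSemisimpleModule_submodule'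
      (p := fun x => LinearMap.range (φ x)) (fun x => .range _) (eq_top_iff.2 fun x _ => ?_)
    refine Submodule.mem_iSup_of_mem x ⟨Submodule.Quotient.mk 1, ?_⟩
    exact one_smul A x
  refine IsIsotypicOfType.linearEquiv_fun fun N _ => ?_
  exact nonempty_linearEquiv_of_annihilator_smul R S fun a ha t => Subtype.ext (hM a ha t)

end SimpleModules

section Conormal

variable {A : Type*} [Ring A]

/-- The module `P / P ^ 2` of a left ideal `P`. -/
abbrev Conormal (P : Ideal A) : Type _ := P ⧸ Submodule.comap P.subtype (P * P)

theorem conormal_smul_eq_zero (P : Ideal A) {a : A} (ha : a ∈ P) (x : Conormal P) : a • x = 0 := by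
  obtain ⟨x, rfl⟩ := Submodule.mkQ_surjective _ x
  exact (Submodule.Quotient.mk_eq_zero _).2 (Ideal.mul_mem_mul ha x.2)

variable (R : Type*) [CommRing R] [IsNoetherianRing R] [Algebra R A] [Module.Finite R A]
  (S : Type*) [AddCommGroup S] [Module A S] [IsSimpleModule A S]

include R in
theorem finite_ideal (P : Ideal A) : Module.Finite A P := by
  have : IsNoetherian R A := isNoetherian_of_isNoetherianRing_of_finite R A
  have : IsNoetherian A A := isNoetherian_of_tower R this
  infer_instance

include R in
theorem exists_linearEquiv_conormal :
    ∃ n : ℕ, Nonempty (Conormal (Module.annihilator A S) ≃ₗ[A] (Fin n → S)) :=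
  have := finite_ideal R (Module.annihilator A S)
  exists_linearEquiv_fun_of_annihilator_smul R S fun _ ha x => conormal_smul_eq_zero _ ha x

/-- Homomorphisms from the annihilator of `S` to `S` factor through the conormal module. -/
noncomputable def homConormalEquiv :
    (Conormal (Module.annihilator A S) →ₗ[A] S) ≃ₗ[Module.End A S]
      (Module.annihilator A S →ₗ[A] S) where
  toFun φ := φ ∘ₗ Submodule.mkQ _
  map_add' _ _ := rfl
  map_smul' _ _ := rfl
  invFun φ := Submodule.liftQ _ φ (by
    rintro ⟨x, hx⟩ hxP
    have hxP' : x ∈ Module.annihilator A S * Module.annihilator A S := hxP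
    rw [LinearMap.mem_ker]
    suffices ∀ hx, φ ⟨x, hx⟩ = 0 from this hx
    clear hxP hx
    induction hxP' using Submodule.mul_induction_on' with
    | mem_mul_mem a ha b hb =>
      intro _
      have : φ (a • ⟨b, hb⟩) = 0 := by rw [map_smul]; exact Module.mem_annihilator.1 ha _
      exact this
    | add x hx y hy hx' hy' =>
      intro _
      have h1 := Ideal.mul_le_left hx
      have h2 := Ideal.mul_le_left hy
      have : φ (⟨x, h1⟩ + ⟨y, h2⟩) = 0 := by rw [map_add, hx', hy', add_zero]
      exact this)
  left_inv φ := Submodule.linearMap_qext _ rfl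
  right_inv φ := rfl

include R in
theorem length_hom_eq :
    Module.length (Module.End A S) (Module.annihilator A S →ₗ[A] S) =
      Module.length A (Conormal (Module.annihilator A S)) := by
  classical
  obtain ⟨n, ⟨e⟩⟩ := exists_linearEquiv_conormal R (A := A) S
  have e1 := (homConormalEquiv S).symm.trans ((e.congrLeft S (Module.End A S)).trans
    (LinearMap.lsum A (fun _ : Fin n => S) (Module.End A S)).symm)
  rw [e1.length_eq, e.length_eq, Module.length_pi_of_fintype, Module.length_pi_of_fintype]
  refine Finset.sum_congr rfl fun i _ => ?_
  rw [Module.length_eq_one A S]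
  have : IsSimpleModule (Module.End A S) (Module.End A S) := inferInstance
  exact Module.length_eq_one _ _

end Conormal

/-! ### The ideal `m A` -/

section SemisimpleQuotient

variable {R : Type u} {A : Type v} [CommRing R] [Ring A] [Algebra R A]

variable (A) in
/-- The two-sided ideal `m A` of the `R`-algebra `A`. -/
def extendedIdeal (m : Ideal R) : Ideal A where
  __ := (m • (⊤ : Submodule R A)).toAddSubmonoid
  smul_mem' c x hx := by
    change c * x ∈ m • (⊤ : Submodule R A)
    have hx' : x ∈ m • (⊤ : Submodule R A) := hx
    clear hx
    induction hx' using Submodule.smul_induction_on' with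
    | smul t ht y _ =>
      rw [mul_smul_comm]
      exact Submodule.smul_mem_smul ht Submodule.mem_top
    | add x _ y _ h1 h2 => rw [mul_add]; exact Submodule.add_mem _ h1 h2

instance (m : Ideal R) : (extendedIdeal A m).IsTwoSided := by
  refine ⟨fun {x} c hx => ?_⟩
  change x * c ∈ m • (⊤ : Submodule R A)
  have hx' : x ∈ m • (⊤ : Submodule R A) := hx
  clear hx
  induction hx' using Submodule.smul_induction_on' with
  | smul t ht y _ =>
    rw [smul_mul_assoc]
    exact Submodule.smul_mem_smul ht Submodule.mem_top
  | add x _ y _ h1 h2 => rw [add_mul]; exact Submodule.add_mem _ h1 h2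

theorem smul_eq_zero_of_mem_extendedIdeal {T : Type*} [AddCommGroup T] [Module A T] {m : Ideal R}
    (hT : ∀ c ∈ m, ∀ t : T, algebraMap R A c • t = 0) {a : A} (ha : a ∈ extendedIdeal A m) (t : T) :
    a • t = 0 := by
  have ha' : a ∈ m • (⊤ : Submodule R A) := ha
  clear ha
  induction ha' using Submodule.smul_induction_on' with
  | smul c hc y _ => rw [Algebra.smul_def, mul_smul, hT c hc]
  | add x _ y _ h1 h2 => rw [add_smul, h1, h2, add_zero]

variable [Module.Finite R A]

variable (A) in
theorem exists_semisimple_quotient (m : Ideal R) [hm : m.IsMaximal] :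
    ∃ (Q : Type v) (_ : Ring Q) (_ : IsSemisimpleRing Q) (π : A →+* Q),
      Function.Surjective π ∧ extendedIdeal A m ≤ RingHom.ker π ∧
        ∃ k, RingHom.ker π ^ (k + 1) ≤ extendedIdeal A m := by
  let I₀ := extendedIdeal A m
  have : IsSimpleModule R (R ⧸ m) := (isSimpleModule_iff_isCoatom).2 hm.out
  have h1 : IsArtinian R (A ⧸ I₀.restrictScalars R) :=
    isArtinian_quotient_of_smul_top_le m _ fun x hx => hx
  have : IsArtinian R (A ⧸ I₀) := h1
  have : IsArtinianRing (A ⧸ I₀) := isArtinian_of_tower R this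
  obtain ⟨k, hk⟩ := IsSemiprimaryRing.isNilpotent (R := A ⧸ I₀)
  let π₀ : A →+* A ⧸ I₀ := Ideal.Quotient.mk I₀
  refine ⟨(A ⧸ I₀) ⧸ Ring.jacobson (A ⧸ I₀), inferInstance, inferInstance,
    (Ideal.Quotient.mk _).comp π₀,
    Ideal.Quotient.mk_surjective.comp Ideal.Quotient.mk_surjective, fun x hx => ?_, k, ?_⟩
  · rw [RingHom.mem_ker, RingHom.comp_apply, Ideal.Quotient.eq_zero_iff_mem.2 hx, map_zero]
  have hker : ∀ x, x ∈ RingHom.ker ((Ideal.Quotient.mk (Ring.jacobson (A ⧸ I₀))).comp π₀) →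
      π₀ x ∈ Ring.jacobson (A ⧸ I₀) := fun x hx => Ideal.Quotient.eq_zero_iff_mem.1 hx
  generalize RingHom.ker ((Ideal.Quotient.mk (Ring.jacobson (A ⧸ I₀))).comp π₀) = W at hker
  have key : ∀ j, ∀ x ∈ W ^ j, π₀ x ∈ Ring.jacobson (A ⧸ I₀) ^ j := by
    intro j
    induction j with
    | zero => intro x _; rw [Submodule.pow_zero, Ideal.one_eq_top]; trivial
    | succ j ih =>
      intro x hx
      rw [Submodule.pow_succ] at hx ⊢
      induction hx using Submodule.mul_induction_on' with
      | mem_mul_mem a ha b hb =>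
        rw [map_mul]; exact Ideal.mul_mem_mul (ih a ha) (hker b hb)
      | add x _ y _ h1 h2 => rw [map_add]; exact Ideal.add_mem _ h1 h2
  intro x hx
  have := key (k + 1) x hx
  rw [Submodule.pow_succ, hk, Submodule.zero_eq_bot, Submodule.bot_mul] at this
  exact Ideal.Quotient.eq_zero_iff_mem.1 this

variable (A) in
/-- An ideal `P` of `A` contains an element `e` such that `(1 - e) P` lies in a two-sided ideal `W`
that contains `m A` and is nilpotent modulo `m A`. -/
theorem exists_mem_one_sub_mul_mem (m : Ideal R) [m.IsMaximal] (P : Ideal A) [P.IsTwoSided] :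
    ∃ W : Ideal A, W.IsTwoSided ∧ extendedIdeal A m ≤ W ∧ (∃ k, W ^ (k + 1) ≤ extendedIdeal A m) ∧
      ∃ e ∈ P, ∀ x ∈ P, (1 - e) * x ∈ W := by
  obtain ⟨Q, _, _, π, hπ, hm, hk⟩ := exists_semisimple_quotient A m
  refine ⟨RingHom.ker π, inferInstance, hm, hk, ?_⟩
  have : (P.map π).IsTwoSided := by
    refine ⟨fun {x} c hx => ?_⟩
    obtain ⟨a, ha, rfl⟩ := (Ideal.mem_map_iff_of_surjective π hπ).1 hx
    obtain ⟨d, rfl⟩ := hπ c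
    rw [← map_mul]
    exact Ideal.mem_map_of_mem _ (P.mul_mem_right _ ha)
  obtain ⟨e, he, hid⟩ := exists_mem_forall_mul_eq_self (P.map π)
  obtain ⟨e, heP, rfl⟩ := (Ideal.mem_map_iff_of_surjective π hπ).1 he
  refine ⟨e, heP, fun x hx => ?_⟩
  rw [RingHom.mem_ker, map_mul, map_sub, map_one, sub_mul, one_mul,
    hid _ (Ideal.mem_map_of_mem _ hx), sub_self]

/-- An ideal some power of which kills a simple module kills the module. -/
theorem smul_eq_zero_of_pow_smul_eq_zero {T : Type*} [AddCommGroup T] [Module A T]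
    [IsSimpleModule A T] {W : Ideal A} [W.IsTwoSided] {k : ℕ}
    (h : ∀ a ∈ W ^ k, ∀ t : T, a • t = 0) {a : A} (ha : a ∈ W) (t : T) : a • t = 0 := by
  let N : Submodule A T :=
    { carrier := {t | ∀ a ∈ W, a • t = 0}
      add_mem' := fun {x y} hx hy a ha => by rw [smul_add, hx a ha, hy a ha, add_zero]
      zero_mem' := fun a _ => smul_zero a
      smul_mem' := fun c x hx a ha => by
        rw [smul_smul]; exact hx _ (W.mul_mem_right _ ha) }
  rcases eq_bot_or_eq_top N with hN | hN
  · have key : ∀ j, ∀ t : T, t ≠ 0 → ∃ a ∈ W ^ j, a • t ≠ 0 := by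
      intro j
      induction j with
      | zero => intro t ht; exact ⟨1, by
        rw [Submodule.pow_zero, Ideal.one_eq_top]; trivial, by simpa using ht⟩
      | succ j ih =>
        intro t ht
        have htN : t ∉ N := by rw [hN]; exact ht
        obtain ⟨b, hb, hbt⟩ : ∃ b ∈ W, b • t ≠ 0 := by
          by_contra hc
          push Not at hc
          exact htN hc
        obtain ⟨c, hc, hct⟩ := ih _ hbt
        exact ⟨c * b, by rw [Submodule.pow_succ]; exact Ideal.mul_mem_mul hc hb, by rwa [mul_smul]⟩
    by_contra hne
    have ht : t ≠ 0 := by rintro rfl; exact hne (smul_zero a)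
    obtain ⟨c, hc, hct⟩ := key k t ht
    exact hct (h c hc t)
  · have : t ∈ N := hN ▸ Submodule.mem_top
    exact this a ha

/-- With `e` and `W` as in `exists_mem_one_sub_mul_mem` for the annihilator `P` of `S`, the element
`e` acts as the identity on each other simple module killed by `m`. -/
theorem smul_eq_self_of_isEmpty {S T : Type*} [AddCommGroup S] [Module A S] [IsSimpleModule A S]
    [AddCommGroup T] [Module A T] [IsSimpleModule A T] (hTS : IsEmpty (T ≃ₗ[A] S))
    {m : Ideal R} (hT : ∀ c ∈ m, ∀ t : T, algebraMap R A c • t = 0)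
    {W : Ideal A} [W.IsTwoSided] {k : ℕ} (hk : W ^ k ≤ extendedIdeal A m) {e : A}
    (he : ∀ x ∈ Module.annihilator A S, (1 - e) * x ∈ W) (t : T) : e • t = t := by
  obtain ⟨x₀, hx₀, t₀, h0⟩ : ∃ x ∈ Module.annihilator A S, ∃ t : T, x • t ≠ 0 := by
    by_contra hc
    push Not at hc
    exact hTS.elim (nonempty_linearEquiv_of_annihilator_smul R S hc).some
  have htop : Submodule.map (LinearMap.toSpanSingleton A T t₀) (Module.annihilator A S) = ⊤ := by
    refine (eq_bot_or_eq_top _).resolve_left fun hbot => h0 ?_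
    have : x₀ • t₀ ∈ Submodule.map (LinearMap.toSpanSingleton A T t₀) (Module.annihilator A S) :=
      ⟨x₀, hx₀, rfl⟩
    rwa [hbot] at this
  obtain ⟨x, hx, rfl⟩ : t ∈ Submodule.map (LinearMap.toSpanSingleton A T t₀) (Module.annihilator A S) :=
    htop ▸ Submodule.mem_top
  have := smul_eq_zero_of_pow_smul_eq_zero
    (fun a ha t => smul_eq_zero_of_mem_extendedIdeal hT (hk ha) t) (he x hx) t₀
  rw [LinearMap.toSpanSingleton_apply, ← mul_smul, ← sub_eq_zero, ← sub_smul, ← neg_eq_zero,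
    ← neg_smul, ← this]
  congr 1
  rw [sub_mul, one_mul]; abel

end SemisimpleQuotient

/-! ### `Ext¹` of simple modules -/

section ExtSimple

variable {A : Type v} [Ring A]

open Abelian

theorem end_smul_ext_def {M N : Type v} [AddCommGroup M] [Module A M] [AddCommGroup N] [Module A N]
    {n : ℕ} (f : Module.End A N) (x : Ext (ModuleCat.of A M) (ModuleCat.of A N) n) :
    f • x = x.comp (Ext.mk₀ (ModuleCat.ofHom f)) (add_zero n) := rfl

/-- The short exact sequence `0 → P → A → A / P → 0` of a left ideal. -/
abbrev idealShortComplex (P : Ideal A) : ShortComplex (ModuleCat.{v} A) :=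
  ShortComplex.mk (ModuleCat.ofHom P.subtype) (ModuleCat.ofHom P.mkQ) (by
    ext x; exact (Submodule.Quotient.mk_eq_zero _).2 x.2)

theorem idealShortComplex_shortExact (P : Ideal A) : (idealShortComplex P).ShortExact where
  exact := (ShortComplex.ShortExact.moduleCat_exact_iff_function_exact _).2
    (LinearMap.exact_subtype_mkQ P)
  mono_f := (ModuleCat.mono_iff_injective _).2 P.subtype_injective
  epi_g := (ModuleCat.epi_iff_surjective _).2 P.mkQ_surjective

/-- The class of the extension `0 → P → A → A / P → 0`. -/
noncomputable def idealExtClass (P : Ideal A) :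
    Ext (ModuleCat.of A (A ⧸ P)) (ModuleCat.of A P) 1 :=
  (idealShortComplex_shortExact P).extClass

/-- The connecting homomorphism from `Hom(P, T)` to `Ext¹(A / P, T)`. -/
noncomputable def connectingHom (P : Ideal A) (T : Type v) [AddCommGroup T] [Module A T] :
    (P →ₗ[A] T) →ₗ[Module.End A T] Ext (ModuleCat.of A (A ⧸ P)) (ModuleCat.of A T) 1 where
  toFun φ := (idealExtClass P).comp (Ext.mk₀ (ModuleCat.ofHom φ)) (add_zero 1)
  map_add' φ ψ := by
    rw [ModuleCat.ofHom_add, Ext.mk₀_add, Ext.comp_add]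
  map_smul' f φ := by
    have : Ext.mk₀ (ModuleCat.ofHom (f • φ)) = (Ext.mk₀ (ModuleCat.ofHom φ)).comp
        (Ext.mk₀ (ModuleCat.ofHom f)) (add_zero 0) := by
      rw [Ext.mk₀_comp_mk₀]; rfl
    rw [this, RingHom.id_apply, end_smul_ext_def, Ext.comp_assoc_of_third_deg_zero]

instance : Projective (ModuleCat.of A A) :=
  (IsProjective.iff_projective A).1 inferInstance

theorem connectingHom_surjective (P : Ideal A) (T : Type v) [AddCommGroup T] [Module A T] :
    Function.Surjective (connectingHom P T) := by
  intro x
  obtain ⟨y, hy⟩ := Ext.contravariant_sequence_exact₃ (idealShortComplex_shortExact P)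
    (ModuleCat.of A T) x (Ext.eq_zero_of_projective _) (add_zero 1)
  obtain ⟨φ, rfl⟩ := Ext.mk₀_bijective _ _ |>.2 y
  exact ⟨φ.hom, hy⟩

theorem connectingHom_eq_zero_iff (P : Ideal A) {T : Type v} [AddCommGroup T] [Module A T]
    (φ : P →ₗ[A] T) : connectingHom P T φ = 0 ↔ ∃ t : T, ∀ x : P, φ x = (x : A) • t := by
  constructor
  · intro h
    obtain ⟨y, hy⟩ := Ext.contravariant_sequence_exact₁ (idealShortComplex_shortExact P)
      (ModuleCat.of A T) _ (add_zero 1) h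
    obtain ⟨ψ, rfl⟩ := Ext.mk₀_bijective _ _ |>.2 y
    rw [Ext.mk₀_comp_mk₀] at hy
    have hy' := Ext.mk₀_bijective _ _ |>.1 hy
    refine ⟨ψ.hom (1 : A), fun x => ?_⟩
    have h1 : φ x = ψ.hom (x : A) := (congrArg (fun g => g.hom x) hy').symm
    rw [h1]
    refine Eq.trans ?_ (ψ.hom.map_smul (x : A) (1 : A))
    exact congrArg ψ.hom (mul_one (x : A)).symm
  · rintro ⟨t, ht⟩
    have : ModuleCat.ofHom φ = (idealShortComplex P).f ≫
        ModuleCat.ofHom (LinearMap.toSpanSingleton A T t) := by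
      ext x; exact ht x
    change (idealShortComplex_shortExact P).extClass.comp (Ext.mk₀ (ModuleCat.ofHom φ)) (add_zero 1) = 0
    rw [this, ← Ext.mk₀_comp_mk₀, ← Ext.comp_assoc_of_second_deg_zero,
      (idealShortComplex_shortExact P).extClass_comp, Ext.zero_comp]

/-- `Ext` turns a finite direct sum in the first variable into a product. -/
noncomputable def extFunEquiv {M S T : Type v} [AddCommGroup M] [Module A M] [AddCommGroup S]
    [Module A S] [AddCommGroup T] [Module A T] {n : ℕ} (e : M ≃ₗ[A] (Fin n → S)) (d : ℕ) :
    Ext (ModuleCat.of A M) (ModuleCat.of A T) d ≃ₗ[Module.End A T]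
      (Fin n → Ext (ModuleCat.of A S) (ModuleCat.of A T) d) where
  toFun x i := (Ext.mk₀ (ModuleCat.ofHom
    (e.symm.toLinearMap ∘ₗ LinearMap.single A (fun _ => S) i))).comp x (zero_add d)
  map_add' x y := by funext i; exact Ext.comp_add _ _ _ _
  map_smul' f x := by
    funext i
    simp only [end_smul_ext_def, RingHom.id_apply, Pi.smul_apply]
    rw [Ext.comp_assoc_of_third_deg_zero]
  invFun y := ∑ i, (Ext.mk₀ (ModuleCat.ofHom
    (LinearMap.proj i ∘ₗ e.toLinearMap))).comp (y i) (zero_add d)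
  left_inv x := by
    simp only [Ext.mk₀_comp_mk₀_assoc]
    rw [← Ext.sum_comp, ← Ext.mk₀_sum]
    convert Ext.mk₀_id_comp x
    ext z
    apply e.injective
    simp only [ModuleCat.hom_sum, ModuleCat.hom_comp, ModuleCat.hom_ofHom, LinearMap.sum_apply,
      LinearMap.comp_apply, map_sum, LinearEquiv.coe_coe, LinearEquiv.apply_symm_apply,
      LinearMap.proj_apply, ModuleCat.hom_id, LinearMap.id_apply]
    exact Finset.univ_sum_single _
  right_inv y := by
    funext j
    simp only [Ext.comp_sum, Ext.mk₀_comp_mk₀_assoc]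
    rw [Finset.sum_eq_single j]
    · convert Ext.mk₀_id_comp (y j)
      ext z
      simp
    · intro i _ hij
      have : ModuleCat.ofHom (e.symm.toLinearMap ∘ₗ LinearMap.single A (fun _ => S) j) ≫
          ModuleCat.ofHom (LinearMap.proj i ∘ₗ e.toLinearMap) = 0 := by
        ext z
        simp [Pi.single_eq_of_ne hij]
      rw [this, Ext.mk₀_zero, Ext.zero_comp]
    · simp

theorem exists_linearEquiv_quotient_annihilator_succ (R : Type u) [CommRing R] [Algebra R A]
    [Module.Finite R A] (S : Type v) [AddCommGroup S] [Module A S] [IsSimpleModule A S] :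
    ∃ n : ℕ, Nonempty ((A ⧸ Module.annihilator A S) ≃ₗ[A] (Fin (n + 1) → S)) := by
  obtain ⟨n, ⟨e⟩⟩ := exists_linearEquiv_quotient_annihilator R (A := A) S
  cases n with
  | zero =>
    exfalso
    have h1 : (Submodule.Quotient.mk 1 : A ⧸ Module.annihilator A S) = 0 :=
      e.injective (Subsingleton.elim _ _)
    have := IsSimpleModule.nontrivial A S
    obtain ⟨s, hs⟩ := exists_ne (0 : S)
    exact hs (by simpa using Module.mem_annihilator.1 ((Submodule.Quotient.mk_eq_zero _).1 h1) s)
  | succ n => exact ⟨n, ⟨e⟩⟩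

/-- `Ext¹(S, T) = 0` if and only if each homomorphism from the annihilator of `S` to `T` extends to
`A`. -/
theorem subsingleton_ext_iff (R : Type u) [CommRing R] [Algebra R A]
    [Module.Finite R A] (S : Type v) [AddCommGroup S] [Module A S] [IsSimpleModule A S]
    (T : Type v) [AddCommGroup T] [Module A T] :
    Subsingleton (Ext (ModuleCat.of A S) (ModuleCat.of A T) 1) ↔
      ∀ φ : Module.annihilator A S →ₗ[A] T, ∃ t : T, ∀ x : Module.annihilator A S,
        φ x = (x : A) • t := by
  obtain ⟨n, ⟨e⟩⟩ := exists_linearEquiv_quotient_annihilator_succ R (A := A) S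
  have e' := extFunEquiv e (T := T) 1
  constructor
  · intro h φ
    rw [← connectingHom_eq_zero_iff]
    exact e'.injective (Subsingleton.elim _ _)
  · intro h
    refine subsingleton_of_forall_eq 0 fun x => ?_
    obtain ⟨φ, hφ⟩ := connectingHom_surjective _ _ (e'.symm fun _ => x)
    rw [(connectingHom_eq_zero_iff _ φ).2 (h φ)] at hφ
    have := congrFun (e'.eq_symm_apply.1 hφ) 0
    rw [← this, map_zero]; rfl

/-- `Ext¹(S, S)` has length one over `End S` if and only if the conormal module of the annihilator
`P` of `S` is as long as `A / P`. -/
theorem length_ext_eq_one_iff (R : Type u) [CommRing R] [IsNoetherianRing R] [Algebra R A]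
    [Module.Finite R A] (S : Type v) [AddCommGroup S] [Module A S] [IsSimpleModule A S] :
    Module.length (Module.End A S) (Ext (ModuleCat.of A S) (ModuleCat.of A S) 1) = 1 ↔
      Module.length A (Conormal (Module.annihilator A S)) =
        Module.length A (A ⧸ Module.annihilator A S) := by
  obtain ⟨n, ⟨e⟩⟩ := exists_linearEquiv_quotient_annihilator_succ R (A := A) S
  have hinj : Function.Injective (connectingHom (Module.annihilator A S) S) := by
    rw [injective_iff_map_eq_zero]
    intro φ hφ
    obtain ⟨t, ht⟩ := (connectingHom_eq_zero_iff _ φ).1 hφ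
    ext x
    rw [ht, LinearMap.zero_apply]
    exact Module.mem_annihilator.1 x.2 t
  have e1 := LinearEquiv.ofBijective _ ⟨hinj, connectingHom_surjective _ S⟩
  have h := (e1.trans (extFunEquiv e (T := S) 1)).length_eq
  rw [length_hom_eq R, Module.length_pi_of_fintype, Finset.sum_const, Finset.card_univ,
    Fintype.card_fin, nsmul_eq_mul] at h
  rw [h, e.length_eq, Module.length_pi_of_fintype, Finset.sum_const, Finset.card_univ,
    Fintype.card_fin, nsmul_eq_mul, Module.length_eq_one A S]
  refine ⟨fun h => by rw [h], fun h => ?_⟩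
  generalize Module.length (Module.End A S) (Ext (ModuleCat.of A S) (ModuleCat.of A S) 1) = ℓ at h
  exact (ENat.mul_right_strictMono (by simp) (by simp)).injective h

end ExtSimple

/-! ### Contraction of ideals -/

section Ideals

variable {R A : Type*} [CommRing R] [Ring A] [Algebra R A]

theorem top_mul_restrictScalars (P : Ideal A) :
    (⊤ : Submodule R A) * P.restrictScalars R = P.restrictScalars R :=
  le_antisymm (Submodule.mul_le.2 fun a _ _ hp => P.mul_mem_left a hp) fun x hx => by
    rw [← one_mul x]; exact Submodule.mul_mem_mul Submodule.mem_top hx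

theorem restrictScalars_mul_top (P : Ideal A) [P.IsTwoSided] :
    P.restrictScalars R * (⊤ : Submodule R A) = P.restrictScalars R :=
  le_antisymm (Submodule.mul_le.2 fun _ hp a _ => P.mul_mem_right a hp) fun x hx => by
    rw [← mul_one x]; exact Submodule.mul_mem_mul hx Submodule.mem_top

theorem restrictScalars_extendedIdeal (m : Ideal R) :
    (extendedIdeal A m).restrictScalars R = m • (⊤ : Submodule R A) := rfl

theorem smul_mem_extendedIdeal {m : Ideal R} {c : R} (hc : c ∈ m) (a : A) :
    c • a ∈ extendedIdeal A m :=
  show c • a ∈ m • (⊤ : Submodule R A) from Submodule.smul_mem_smul hc Submodule.mem_top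

/-- The annihilator of a simple module is maximal among the two-sided ideals. -/
theorem sup_annihilator_eq_top (R : Type*) [CommRing R] [Algebra R A] [Module.Finite R A]
    (S : Type*) [AddCommGroup S] [Module A S] [IsSimpleModule A S] {Z : Ideal A} [Z.IsTwoSided]
    (hZ : ¬ Z ≤ Module.annihilator A S) : Z ⊔ Module.annihilator A S = ⊤ := by
  by_contra hne
  obtain ⟨M, hM, hle⟩ := Ideal.exists_le_maximal _ hne
  have : IsSimpleModule A (A ⧸ M) := isSimpleModule_iff_isCoatom.2 hM.out
  have hkill : ∀ J : Ideal A, J.IsTwoSided → J ≤ M → ∀ a ∈ J, ∀ t : A ⧸ M, a • t = 0 := by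
    intro J _ hJ a ha t
    obtain ⟨t, rfl⟩ := Submodule.mkQ_surjective _ t
    exact (Submodule.Quotient.mk_eq_zero _).2 (hJ (J.mul_mem_right t ha))
  obtain ⟨e⟩ := nonempty_linearEquiv_of_annihilator_smul R S (T := A ⧸ M)
    (hkill _ inferInstance (le_sup_right.trans hle))
  refine hZ fun a ha => Module.mem_annihilator.2 fun s => ?_
  rw [← e.apply_symm_apply s, ← map_smul, hkill Z inferInstance (le_sup_left.trans hle) a ha,
    map_zero]

end Ideals

theorem smul_mul_smul_le {R L : Type*} [CommRing R] [Ring L] [Algebra R L] (I J : Ideal R)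
    (M N : Submodule R L) : (I • M) * (J • N) ≤ (I * J) • (M * N) := by
  rw [Submodule.mul_le]
  intro y hy z hz
  induction hy using Submodule.smul_induction_on' with
  | smul a ha y hy =>
    induction hz using Submodule.smul_induction_on' with
    | smul b hb z hz =>
      rw [smul_mul_smul_comm]
      exact Submodule.smul_mem_smul (Ideal.mul_mem_mul ha hb) (Submodule.mul_mem_mul hy hz)
    | add x _ z _ h1 h2 => rw [mul_add]; exact Submodule.add_mem _ h1 h2
  | add x _ y _ h1 h2 => rw [add_mul]; exact Submodule.add_mem _ h1 h2

section Contraction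

variable {R R' A L : Type*} [CommRing R] [CommRing R'] [Ring A] [Algebra R A]
  [Ring L] [Algebra R L] [Algebra R' L]

/-- The largest left ideal of `A` that is mapped into `N` by `f`. -/
def contractedIdeal (f : A →ₐ[R] L) (N : Submodule R' L) : Ideal A where
  carrier := {a | ∀ b, f (b * a) ∈ N}
  add_mem' {x y} hx hy b := by rw [mul_add, map_add]; exact N.add_mem (hx b) (hy b)
  zero_mem' b := by simp
  smul_mem' c x hx b := by
    rw [smul_eq_mul, ← mul_assoc]; exact hx _

variable {f : A →ₐ[R] L} {B : Subalgebra R' L} {m : Ideal R} [m.IsPrime]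

theorem contractedIdeal_mono {N N' : Submodule R' L} (h : N ≤ N') :
    contractedIdeal f N ≤ contractedIdeal f N' := fun _ ha b => h (ha b)

namespace IsLocalizedSubalgebra

variable (h : IsLocalizedSubalgebra m f B)

include h

theorem mem_contractedIdeal {N : Submodule R' L} (hN : Subalgebra.toSubmodule B * N ≤ N) {a : A} :
    a ∈ contractedIdeal f N ↔ f a ∈ N :=
  ⟨fun ha => by simpa using ha 1, fun ha b => by
    rw [map_mul]; exact hN (Submodule.mul_mem_mul (h.apply_mem b) ha)⟩

variable [Algebra R R'] [IsScalarTower R R' L] [IsLocalization.AtPrime R' m]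

theorem localizedSubmodule_contractedIdeal {N : Submodule R' L}
    (hN : Subalgebra.toSubmodule B * N ≤ N) (hNB : N ≤ Subalgebra.toSubmodule B) :
    localizedSubmodule R' f ((contractedIdeal f N).restrictScalars R) = N := by
  convert h.localizedSubmodule_comap hNB using 2
  ext a
  exact h.mem_contractedIdeal hN

theorem mul_localizedSubmodule (P : Ideal A) :
    Subalgebra.toSubmodule B * localizedSubmodule R' f (P.restrictScalars R) =
      localizedSubmodule R' f (P.restrictScalars R) := by
  rw [← h.localizedSubmodule_top, ← localizedSubmodule_mul, top_mul_restrictScalars]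

theorem localizedSubmodule_mul_self (P : Ideal A) [P.IsTwoSided] :
    localizedSubmodule R' f (P.restrictScalars R) * Subalgebra.toSubmodule B =
      localizedSubmodule R' f (P.restrictScalars R) := by
  rw [← h.localizedSubmodule_top, ← localizedSubmodule_mul, restrictScalars_mul_top]

theorem contractedIdeal_localizedSubmodule [m.IsMaximal] {X : Ideal A}
    (hX : extendedIdeal A m ≤ X) :
    contractedIdeal f (localizedSubmodule R' f (X.restrictScalars R)) = X := by
  ext a
  rw [h.mem_contractedIdeal (h.mul_localizedSubmodule X).le]
  exact ⟨fun ha => h.mem_of_apply_mem ha fun t ht => hX (smul_mem_extendedIdeal ht a),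
    fun ha => apply_mem_localizedSubmodule ha⟩

theorem localizedSubmodule_extendedIdeal :
    localizedSubmodule R' f ((extendedIdeal A m).restrictScalars R) =
      m.map (algebraMap R R') • Subalgebra.toSubmodule B := by
  rw [restrictScalars_extendedIdeal]
  refine le_antisymm (Submodule.span_le.2 ?_) ?_
  · rintro _ ⟨a, ha, rfl⟩
    induction ha using Submodule.smul_induction_on' with
    | smul t ht y _ =>
      rw [map_smul, ← algebraMap_smul R' t (f y)]
      exact Submodule.smul_mem_smul (Ideal.mem_map_of_mem _ ht) (h.apply_mem y)
    | add x _ y _ h1 h2 => rw [map_add]; exact Submodule.add_mem _ h1 h2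
  · rw [Submodule.smul_le]
    intro c hc b hb
    induction hc using Submodule.span_induction with
    | mem c hc =>
      obtain ⟨t, ht, rfl⟩ := hc
      obtain ⟨s, hs, a, hsa⟩ := (h.mem_iff b).1 hb
      rw [algebraMap_smul]
      refine (mem_localizedSubmodule m).2 ⟨s, hs, t • a,
        Submodule.smul_mem_smul ht Submodule.mem_top, ?_⟩
      rw [smul_comm, hsa, map_smul]
    | zero => rw [zero_smul]; exact Submodule.zero_mem _
    | add x y _ _ h1 h2 => rw [add_smul]; exact Submodule.add_mem _ h1 h2
    | smul c x _ h1 => rw [smul_assoc]; exact Submodule.smul_mem _ _ h1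

variable [Module.Finite R A] {S : Type*} [AddCommGroup S] [Module A S] [IsSimpleModule A S]

/-- The localization of the annihilator of a simple module is maximal among the two-sided
ideals. -/
theorem le_sup_localizedSubmodule_annihilator (M : Submodule R' L)
    (hBM : Subalgebra.toSubmodule B * M ≤ M) (hMB : M * Subalgebra.toSubmodule B ≤ M)
    (hM : M ≤ Subalgebra.toSubmodule B)
    (hMI : ¬ M ≤ localizedSubmodule R' f ((Module.annihilator A S).restrictScalars R)) :
    Subalgebra.toSubmodule B ≤
      M ⊔ localizedSubmodule R' f ((Module.annihilator A S).restrictScalars R) := by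
  have : (contractedIdeal f M).IsTwoSided := ⟨fun {a} c ha b => by
    rw [← mul_assoc, map_mul]; exact hMB (Submodule.mul_mem_mul (ha b) (h.apply_mem c))⟩
  have hZ : ¬ contractedIdeal f M ≤ Module.annihilator A S := fun hle => hMI <| by
    rw [← h.localizedSubmodule_contractedIdeal hBM hM]
    exact localizedSubmodule_mono hle
  have htop := sup_annihilator_eq_top R S hZ
  rw [← h.localizedSubmodule_top, ← h.localizedSubmodule_contractedIdeal hBM hM,
    ← localizedSubmodule_sup]
  refine localizedSubmodule_mono fun a _ => ?_
  obtain ⟨x, hx, y, hy, rfl⟩ := Submodule.mem_sup.1 (htop ▸ Submodule.mem_top (x := a))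
  exact Submodule.add_mem_sup hx hy

omit [Module.Finite R A] in
theorem one_notMem_localizedSubmodule [m.IsMaximal] {P : Ideal A} (hP : P ≠ ⊤)
    (hmP : extendedIdeal A m ≤ P) : 1 ∉ localizedSubmodule R' f (P.restrictScalars R) := by
  intro h1
  refine hP ((Ideal.eq_top_iff_one P).2 ?_)
  rw [← h.contractedIdeal_localizedSubmodule hmP,
    h.mem_contractedIdeal (h.mul_localizedSubmodule P).le, map_one]
  exact h1

end IsLocalizedSubalgebra

theorem annihilator_ne_top (A S : Type*) [Ring A] [AddCommGroup S] [Module A S]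
    [IsSimpleModule A S] : Module.annihilator A S ≠ ⊤ := by
  have := IsSimpleModule.nontrivial A S
  intro htop
  obtain ⟨s, hs⟩ := exists_ne (0 : S)
  have : (1 : A) ∈ Module.annihilator A S := htop ▸ Submodule.mem_top
  exact hs (by simpa using Module.mem_annihilator.1 this s)

theorem extendedIdeal_le_annihilator {S : Type*} [AddCommGroup S] [Module A S]
    {m : Ideal R} (hmS : ∀ c ∈ m, ∀ s : S, algebraMap R A c • s = 0) :
    extendedIdeal A m ≤ Module.annihilator A S := fun _ ha =>
  Module.mem_annihilator.2 (smul_eq_zero_of_mem_extendedIdeal hmS ha)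

theorem algebraMap_mem_localizedSubmodule [Algebra R R'] [IsScalarTower R R' L] {P : Ideal A}
    {m : Ideal R} (hmP : extendedIdeal A m ≤ P) {r : R} (hr : r ∈ m) :
    algebraMap R' L (algebraMap R R' r) ∈ localizedSubmodule R' f (P.restrictScalars R) := by
  rw [← IsScalarTower.algebraMap_apply, ← f.commutes]
  refine apply_mem_localizedSubmodule (hmP ?_)
  rw [Algebra.algebraMap_eq_smul_one]
  exact smul_mem_extendedIdeal hr 1

end Contraction

/-! ### Maximality and the annihilator of a simple module -/

section Criterion

variable {R : Type u} {R' : Type*} {A : Type v} {L : Type*} [CommRing R] [CommRing R']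
  [IsLocalRing R'] [IsNoetherianRing R'] [Ring A] [Algebra R A] [Module.Finite R A]
  [Ring L] [Algebra R L] [Algebra R' L] [Algebra R R'] [IsScalarTower R R' L]
  {f : A →ₐ[R] L} {B : Subalgebra R' L} {m : Ideal R} [m.IsMaximal] [IsLocalization.AtPrime R' m]
  (h : IsLocalizedSubalgebra m f B) {r : R} (hr : r ∈ m)
  (hB : IsLocalOrder B (algebraMap R R' r))
  {S : Type v} [AddCommGroup S] [Module A S] [IsSimpleModule A S]
  (hmS : ∀ c ∈ m, ∀ s : S, algebraMap R A c • s = 0)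

include h hr hB hmS in
/-- Localized at `m`, an order with no proper overring has an invertible ideal: the localization of
the annihilator of a simple module killed by `m`. -/
theorem exists_isInverseIdeal_annihilator (hmax : HasNoFiniteOverring B) :
    ∃ Y, IsInverseIdeal (Subalgebra.toSubmodule B)
      (localizedSubmodule R' f ((Module.annihilator A S).restrictScalars R)) Y := by
  set P := Module.annihilator A S with hP
  obtain ⟨W, _, hmW, ⟨k, hk⟩, e, heP, he⟩ := exists_mem_one_sub_mul_mem A m P
  have hmP : extendedIdeal A m ≤ P := extendedIdeal_le_annihilator hmS
  let X : Ideal A :=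
    { carrier := {a | ∀ p ∈ P, a * p ∈ W}
      add_mem' := fun {x y} hx hy p hp => by rw [add_mul]; exact W.add_mem (hx p hp) (hy p hp)
      zero_mem' := fun p _ => by rw [zero_mul]; exact W.zero_mem
      smul_mem' := fun c x hx p hp => by
        rw [smul_eq_mul, mul_assoc]; exact W.mul_mem_left c (hx p hp) }
  have hmX : extendedIdeal A m ≤ X := fun a ha p _ => hmW (Ideal.mul_mem_right p _ ha)
  refine hB.exists_isInverseIdeal hmax
    (X := localizedSubmodule R' f (X.restrictScalars R))
    (h.mul_localizedSubmodule P) (h.localizedSubmodule_mul_self P) (h.localizedSubmodule_le _)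
    (h.localizedSubmodule_le _) (algebraMap_mem_localizedSubmodule hmP hr) ?_
    (h.one_notMem_localizedSubmodule (annihilator_ne_top A S) hmP) ?_ ?_
    (h.le_sup_localizedSubmodule_annihilator)
  · exact algebraMap_mem_localizedSubmodule (R' := R') (f := f) hmX hr
  · rw [← h.localizedSubmodule_top, ← localizedSubmodule_sup]
    refine localizedSubmodule_mono fun a _ => ?_
    have : a = a * (1 - e) + a * e := by rw [← mul_add, sub_add_cancel, mul_one]
    rw [this]
    exact Submodule.add_mem_sup (X.mul_mem_left a he) (P.mul_mem_left a heP)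
  · obtain ⟨j, hj⟩ := hB.exists_pow_le
    refine ⟨(k + 1) * j, ?_⟩
    have hBB := Subalgebra.isIdempotentElem_toSubmodule B
    have h1 : (localizedSubmodule R' f (X.restrictScalars R) *
        localizedSubmodule R' f (P.restrictScalars R)) ^ (k + 1) ≤
        IsLocalRing.maximalIdeal R' • Subalgebra.toSubmodule B := by
      rw [← IsLocalization.AtPrime.map_eq_maximalIdeal m R',
        ← h.localizedSubmodule_extendedIdeal, ← localizedSubmodule_mul, ← localizedSubmodule_pow]
      refine localizedSubmodule_mono ((pow_le_pow_left' (a := X.restrictScalars R *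
        P.restrictScalars R) (b := W.restrictScalars R)
        (Submodule.mul_le.2 fun x hx p hp => hx p hp) _).trans ?_)
      rw [← Submodule.restrictScalars_pow k.succ_ne_zero]
      exact hk
    have h2 : ∀ n, (IsLocalRing.maximalIdeal R' • Subalgebra.toSubmodule B) ^ n ≤
        IsLocalRing.maximalIdeal R' ^ n • Subalgebra.toSubmodule B := by
      intro n
      induction n with
      | zero => simp
      | succ n ih =>
        rw [pow_succ, pow_succ]
        refine (mul_le_mul' ih le_rfl).trans ((smul_mul_smul_le _ _ _ _).trans ?_)
        rw [hBB.eq]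
    rw [pow_mul, scalarSpan_mul_eq_smul]
    exact (pow_le_pow_left' h1 j).trans ((h2 j).trans (Submodule.smul_mono_left hj))

include h hr hB hmS in
/-- If `B` has no proper finite overring, the annihilator of `S` is nilpotent modulo `m A`; so `S` is
the only simple module killed by `m`. -/
theorem exists_annihilator_pow_le (hmax : HasNoFiniteOverring B) :
    ∃ k, Module.annihilator A S ^ (k + 1) ≤ extendedIdeal A m := by
  obtain ⟨Y, hY⟩ := exists_isInverseIdeal_annihilator h hr hB hmS hmax
  have hmP : extendedIdeal A m ≤ Module.annihilator A S := extendedIdeal_le_annihilator hmS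
  obtain ⟨k, hk⟩ := hY.exists_pow_le B hB.fg _ hB.isArtinian hB.exists_algebraMap_eq
    (algebraMap_mem_localizedSubmodule hmP hr)
    (h.one_notMem_localizedSubmodule (annihilator_ne_top A S) hmP)
  refine ⟨k, fun a ha => ?_⟩
  rw [← h.contractedIdeal_localizedSubmodule le_rfl,
    h.mem_contractedIdeal (h.mul_localizedSubmodule _).le, h.localizedSubmodule_extendedIdeal,
    IsLocalization.AtPrime.map_eq_maximalIdeal m R']
  have hle : scalarSpan L (algebraMap R R' r) * Subalgebra.toSubmodule B ≤
      IsLocalRing.maximalIdeal R' • Subalgebra.toSubmodule B := by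
    rw [scalarSpan_mul_eq_smul]
    exact Submodule.smul_mono_left ((Ideal.span_singleton_le_iff_mem _).2 hB.mem_maximalIdeal)
  refine hle (hk ?_)
  rw [← localizedSubmodule_pow, ← Submodule.restrictScalars_pow k.succ_ne_zero]
  exact apply_mem_localizedSubmodule ha

include h hr hB hmS in
/-- If `m` does not kill the simple module `T`, some scalar acts invertibly on `T` but by zero on
`S`; otherwise a power of the annihilator of `S` kills `T`, which forces `T ≃ S`. -/
theorem exists_forall_eq_smul_of_hasNoFiniteOverring (hmax : HasNoFiniteOverring B)
    {T : Type*} [AddCommGroup T] [Module A T] [IsSimpleModule A T] (hTS : IsEmpty (T ≃ₗ[A] S))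
    (φ : Module.annihilator A S →ₗ[A] T) :
    ∃ t : T, ∀ x : Module.annihilator A S, φ x = (x : A) • t := by
  by_cases hT : ∀ c ∈ m, ∀ t : T, algebraMap R A c • t = 0
  · obtain ⟨k, hk⟩ := exists_annihilator_pow_le h hr hB hmS hmax
    refine hTS.elim (nonempty_linearEquiv_of_annihilator_smul R S fun a ha t => ?_).some
    exact smul_eq_zero_of_pow_smul_eq_zero
      (fun b hb t => smul_eq_zero_of_mem_extendedIdeal hT (hk hb) t) ha t
  · push Not at hT
    obtain ⟨c, hc, t₀, ht₀⟩ := hT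
    let μ : T →ₗ[A] T :=
      { toFun := fun t => algebraMap R A c • t
        map_add' := smul_add _
        map_smul' := fun a t => by
          rw [RingHom.id_apply, smul_smul, smul_smul, Algebra.commutes] }
    have hμ : Function.Bijective μ :=
      LinearMap.bijective_of_ne_zero fun h0 => ht₀ (LinearMap.congr_fun h0 t₀)
    let p : Module.annihilator A S := ⟨algebraMap R A c, Module.mem_annihilator.2 (hmS c hc)⟩
    obtain ⟨t, ht⟩ := hμ.2 (φ p)
    refine ⟨t, fun x => hμ.1 ?_⟩
    have h1 : μ (φ x) = φ ((x : A) • p) := by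
      change algebraMap R A c • φ x = _
      rw [← map_smul]
      exact congrArg φ (Subtype.ext (Algebra.commutes c (x : A)))
    rw [h1, map_smul, ← ht, map_smul]

include h hmS in
omit [IsLocalRing R'] [IsNoetherianRing R'] [Module.Finite R A] [IsSimpleModule A S] in
/-- Multiplication by the inverse ideal identifies the submodules of the annihilator `P` of `S` that
contain `P * P` with the left ideals containing `P`. -/
theorem nonempty_orderIso_Ici_annihilator {Y : Submodule R' L}
    (hY : IsInverseIdeal (Subalgebra.toSubmodule B)
      (localizedSubmodule R' f ((Module.annihilator A S).restrictScalars R)) Y) :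
    Nonempty (Set.Ici (Module.annihilator A S) ≃o Set.Ici (Submodule.comap
      (Module.annihilator A S).subtype (Module.annihilator A S * Module.annihilator A S))) := by
  have hmP : extendedIdeal A m ≤ Module.annihilator A S := extendedIdeal_le_annihilator hmS
  have hP2 : ∀ t ∈ m, ∀ x ∈ Module.annihilator A S,
      t • x ∈ Module.annihilator A S * Module.annihilator A S := fun t ht x hx => by
    rw [Algebra.smul_def]
    exact Ideal.mul_mem_mul (Module.mem_annihilator.2 (hmS t ht)) hx
  generalize Module.annihilator A S = P at *
  set I := localizedSubmodule R' f (P.restrictScalars R) with hI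
  have hPP : localizedSubmodule R' f ((P * P).restrictScalars R) = I * I := by
    rw [hI, ← localizedSubmodule_mul, Submodule.restrictScalars_mul]
  have hBl : ∀ X : Ideal A, Subalgebra.toSubmodule B *
      (I * localizedSubmodule R' f (X.restrictScalars R)) =
        I * localizedSubmodule R' f (X.restrictScalars R) := fun X => by
    rw [← mul_assoc, hY.mul_left]
  have hBY : ∀ N : Submodule R' L, Subalgebra.toSubmodule B * (Y * N) = Y * N := fun N => by
    rw [← mul_assoc, hY.inv_mul_left]
  have hIX : ∀ X : Ideal A, I * localizedSubmodule R' f (X.restrictScalars R) ≤ I := fun X =>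
    (mul_le_mul' le_rfl (h.localizedSubmodule_le _)).trans_eq hY.mul_right
  have hKI : ∀ K : Submodule A P,
      localizedSubmodule R' f ((K.map P.subtype).restrictScalars R) ≤ I := fun K =>
    localizedSubmodule_mono (Submodule.map_subtype_le _ _)
  have hcI : contractedIdeal f I = P := h.contractedIdeal_localizedSubmodule hmP
  let F : Ideal A → Submodule A P := fun X => Submodule.comap P.subtype (contractedIdeal f
        (I * localizedSubmodule R' f (X.restrictScalars R)))
  let G : Submodule A P → Ideal A := fun K => contractedIdeal f
        (Y * localizedSubmodule R' f ((K.map P.subtype).restrictScalars R))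
  have hF : Monotone F := fun X X' hX => Submodule.comap_mono (contractedIdeal_mono
        (mul_le_mul' le_rfl (localizedSubmodule_mono hX)))
  have hG : Monotone G := fun K K' hK => contractedIdeal_mono (mul_le_mul' le_rfl
        (localizedSubmodule_mono (Submodule.map_mono hK)))
  have hF1 : ∀ X, P ≤ X → Submodule.comap P.subtype (P * P) ≤ F X := fun X hX =>
    Submodule.comap_mono fun a ha => by
      rw [h.mem_contractedIdeal (hBl X).le]
      refine mul_le_mul' le_rfl (localizedSubmodule_mono hX) (?_ : f a ∈ I * I)
      rw [← hPP]
      exact apply_mem_localizedSubmodule ha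
  have hG1 : ∀ K, Submodule.comap P.subtype (P * P) ≤ K → P ≤ G K := fun K hK => by
    refine hcI.ge.trans (contractedIdeal_mono ?_)
    calc I = Y * (I * I) := by rw [← mul_assoc, hY.inv_mul, hY.mul_left]
      _ ≤ _ := mul_le_mul' le_rfl ?_
    rw [← hPP]
    refine localizedSubmodule_mono fun a ha => ?_
    exact ⟨⟨a, Ideal.mul_le_right ha⟩, hK ha, rfl⟩
  have hGF : ∀ X, P ≤ X → G (F X) = X := fun X hX => by
    have hle : contractedIdeal f (I * localizedSubmodule R' f (X.restrictScalars R)) ≤ P :=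
      (contractedIdeal_mono (hIX X)).trans hcI.le
    change contractedIdeal f (Y * localizedSubmodule R' f
      ((Submodule.map P.subtype (Submodule.comap P.subtype _)).restrictScalars R)) = _
    rw [Submodule.map_comap_subtype, inf_eq_right.2 hle,
      h.localizedSubmodule_contractedIdeal (hBl X).le ((hIX X).trans hY.le), ← mul_assoc,
      hY.inv_mul, h.mul_localizedSubmodule,
      h.contractedIdeal_localizedSubmodule (hmP.trans hX)]
  have hFG : ∀ K, Submodule.comap P.subtype (P * P) ≤ K → F (G K) = K := fun K hK => by
    change Submodule.comap P.subtype (contractedIdeal f (I * localizedSubmodule R' f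
      ((contractedIdeal f _).restrictScalars R))) = _
    rw [h.localizedSubmodule_contractedIdeal (hBY _).le
      ((mul_le_mul' le_rfl (hKI K)).trans_eq hY.inv_mul), ← mul_assoc, hY.mul_inv,
      h.mul_localizedSubmodule]
    ext x
    rw [Submodule.mem_comap, h.mem_contractedIdeal (h.mul_localizedSubmodule _).le]
    constructor
    · intro hx
      obtain ⟨y, hy, hyx⟩ := h.mem_of_apply_mem hx fun t ht =>
        ⟨t • x, hK (hP2 t ht x x.2), rfl⟩
      rwa [← Subtype.ext (a1 := y) (a2 := x) hyx]
    · intro hx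
      exact apply_mem_localizedSubmodule ⟨x, hx, rfl⟩
  exact ⟨{ toFun := fun X => ⟨F X, hF1 X X.2⟩
           invFun := fun K => ⟨G K, hG1 K K.2⟩
           left_inv := fun X => Subtype.ext (hGF X X.2)
           right_inv := fun K => Subtype.ext (hFG K K.2)
           map_rel_iff' := fun {X X'} => ⟨fun hX => by
             have := hG (show F X ≤ F X' from hX)
             rwa [hGF X X.2, hGF X' X'.2] at this, fun hX => hF hX⟩ }⟩

include h hr hB hmS in
/-- The annihilator `P` of `S` is invertible after localization, so `P / P * P` and `A / P` have
isomorphic submodule lattices. -/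
theorem length_conormal_eq_of_hasNoFiniteOverring (hmax : HasNoFiniteOverring B) :
    Module.length A (Conormal (Module.annihilator A S)) =
      Module.length A (A ⧸ Module.annihilator A S) := by
  obtain ⟨Y, hY⟩ := exists_isInverseIdeal_annihilator h hr hB hmS hmax
  obtain ⟨e⟩ := nonempty_orderIso_Ici_annihilator h hmS hY
  have e' := (Submodule.comapMkQRelIso (Module.annihilator A S)).trans
    (e.trans (Submodule.comapMkQRelIso _).symm)
  have := Order.krullDim_eq_of_orderIso e'
  rw [← Module.coe_length, ← Module.coe_length] at this
  exact (WithBot.coe_injective this).symm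

/-- Under the two `Ext` conditions, the annihilator `P` of `S` is generated modulo `m P` by one
element `x`: no simple quotient of `P / m P` vanishes on `x`. -/
theorem exists_annihilator_le_span_sup [IsNoetherianRing R]
    (h1 : Module.length A (Conormal (Module.annihilator A S)) =
      Module.length A (A ⧸ Module.annihilator A S))
    (h2 : ∀ (T : Type v) [AddCommGroup T] [Module A T] [IsSimpleModule A T],
      IsEmpty (T ≃ₗ[A] S) → ∀ φ : Module.annihilator A S →ₗ[A] T,
        ∃ t : T, ∀ x : Module.annihilator A S, φ x = (x : A) • t) :
    ∃ x ∈ Module.annihilator A S, Module.annihilator A S ≤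
      Ideal.span {x} ⊔ extendedIdeal A m * Module.annihilator A S := by
  have := finite_ideal R (Module.annihilator A S)
  obtain ⟨n₁, ⟨e₁⟩⟩ := exists_linearEquiv_quotient_annihilator R (A := A) S
  obtain ⟨n₂, ⟨e₂⟩⟩ := exists_linearEquiv_conormal R (A := A) S
  obtain rfl : n₂ = n₁ := by
    rw [e₁.length_eq, e₂.length_eq, Module.length_pi_of_fintype, Module.length_pi_of_fintype] at h1
    simpa using h1
  set P := Module.annihilator A S with hP
  -- `P / P * P` is isomorphic to `A / P`, so it has a generator `y`
  obtain ⟨y, hy⟩ : ∃ y : P, ∀ z : P, ∃ a : A, (z : A) - a * y ∈ P * P := by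
    obtain ⟨y, hy⟩ := Submodule.mkQ_surjective _ (e₂.symm (e₁ (Submodule.Quotient.mk 1)))
    refine ⟨y, fun z => ?_⟩
    obtain ⟨a, ha⟩ := Submodule.mkQ_surjective _
      (e₁.symm (e₂ (Submodule.mkQ (Submodule.comap P.subtype (P * P)) z)))
    refine ⟨a, ?_⟩
    have : Submodule.mkQ (Submodule.comap P.subtype (P * P)) z =
        Submodule.mkQ (Submodule.comap P.subtype (P * P)) (a • y) := by
      rw [map_smul, hy, ← map_smul, ← map_smul, ← Submodule.Quotient.mk_smul, smul_eq_mul, mul_one,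
        ← Submodule.mkQ_apply, ha, LinearEquiv.apply_symm_apply, LinearEquiv.symm_apply_apply]
    exact (Submodule.Quotient.eq (Submodule.comap P.subtype (P * P))).1 this
  obtain ⟨W, _, -, ⟨k, hk⟩, e, heP, he⟩ := exists_mem_one_sub_mul_mem A m P
  -- correct `y` within its class modulo `P * P` so that it acts as the identity on the simple
  -- modules not isomorphic to `S`
  let x : A := (1 - e * e) * y + e * e
  have hxy : (y : A) - x ∈ P * P := by
    have : (y : A) - x = e * (e * (y - 1)) := by simp only [x]; noncomm_ring
    rw [this]
    exact Ideal.mul_mem_mul heP (P.mul_mem_right _ heP)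
  have hx : x ∈ P := P.add_mem (P.mul_mem_left _ y.2) (P.mul_mem_left _ heP)
  refine ⟨x, hx, ?_⟩
  by_contra hle
  obtain ⟨N, hN, hle'⟩ := (eq_top_or_exists_le_coatom (Submodule.comap P.subtype
    (Ideal.span {x} ⊔ extendedIdeal A m * P))).resolve_left fun htop => hle fun z hz => by
      have : (⟨z, hz⟩ : P) ∈ Submodule.comap P.subtype
        (Ideal.span {x} ⊔ extendedIdeal A m * P) := htop ▸ Submodule.mem_top
      exact this
  have : IsSimpleModule A (P ⧸ N) := isSimpleModule_iff_isCoatom.2 hN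
  have hxN : (⟨x, hx⟩ : P) ∈ N := hle' (Submodule.mem_sup_left (Ideal.mem_span_singleton_self x))
  have hmT : ∀ c ∈ m, ∀ t : P ⧸ N, algebraMap R A c • t = 0 := by
    intro c hc t
    obtain ⟨p, rfl⟩ := Submodule.mkQ_surjective _ t
    refine (Submodule.Quotient.mk_eq_zero _).2 (hle' (Submodule.mem_sup_right ?_))
    refine Ideal.mul_mem_mul ?_ p.2
    rw [Algebra.algebraMap_eq_smul_one]
    exact smul_mem_extendedIdeal hc 1
  refine hN.1 (eq_top_iff.2 fun z _ => ?_)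
  rcases isEmpty_or_nonempty ((P ⧸ N) ≃ₗ[A] S) with hT | ⟨⟨ε⟩⟩
  · obtain ⟨t, ht⟩ := h2 (P ⧸ N) hT N.mkQ
    have het : e • t = t := smul_eq_self_of_isEmpty hT hmT hk he t
    have hyt : ∀ t' : P ⧸ N, e • t' = t' := smul_eq_self_of_isEmpty hT hmT hk he
    have hxt : x • t = t := by
      simp only [x, add_smul, sub_smul, mul_smul, one_smul, hyt, sub_self, zero_add]
    have ht0 : t = 0 := by
      rw [← hxt, ← ht ⟨x, hx⟩]
      exact (Submodule.Quotient.mk_eq_zero _).2 hxN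
    exact (Submodule.Quotient.mk_eq_zero _).1 ((ht z).trans (by rw [ht0, smul_zero]))
  · have hPPN : P * P ≤ N.map P.subtype := Ideal.mul_le.2 fun a ha b hb => by
      refine ⟨a • ⟨b, hb⟩, (Submodule.Quotient.mk_eq_zero _).1 (ε.injective ?_), rfl⟩
      rw [Submodule.Quotient.mk_smul, map_smul, map_zero, Module.mem_annihilator.1 ha]
    obtain ⟨a, ha⟩ := hy z
    have : (z : A) ∈ N.map P.subtype := by
      have hz : (z : A) = (z - a * y) + a * (y - x) + a * x := by noncomm_ring
      rw [hz]
      exact Submodule.add_mem _ (Submodule.add_mem _ (hPPN ha)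
        (Ideal.mul_mem_left _ a (hPPN hxy))) (Ideal.mul_mem_left _ a ⟨_, hxN, rfl⟩)
    obtain ⟨z', hz', hzz⟩ := this
    rwa [← Subtype.ext (a1 := z') (a2 := z) hzz]

include h hr hB hmS in
/-- Here the localization of the annihilator of `S` is a principal left ideal, by Nakayama's lemma,
hence invertible. -/
theorem hasNoFiniteOverring_of_forall_exists_smul [IsSemisimpleRing L] [IsNoetherianRing R]
    (h1 : Module.length A (Conormal (Module.annihilator A S)) =
      Module.length A (A ⧸ Module.annihilator A S))
    (h2 : ∀ (T : Type v) [AddCommGroup T] [Module A T] [IsSimpleModule A T],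
      IsEmpty (T ≃ₗ[A] S) → ∀ φ : Module.annihilator A S →ₗ[A] T,
        ∃ t : T, ∀ x : Module.annihilator A S, φ x = (x : A) • t) :
    HasNoFiniteOverring B := by
  obtain ⟨x, hx, hle⟩ := exists_annihilator_le_span_sup (m := m) h1 h2
  have hmP : extendedIdeal A m ≤ Module.annihilator A S := extendedIdeal_le_annihilator hmS
  have hrI := algebraMap_mem_localizedSubmodule (R' := R') (L := L) (f := f) hmP hr
  have h1I := h.one_notMem_localizedSubmodule (annihilator_ne_top A S) hmP
  have hmax := h.le_sup_localizedSubmodule_annihilator (S := S)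
  have hBI := h.mul_localizedSubmodule (Module.annihilator A S)
  have hIB := h.localizedSubmodule_mul_self (Module.annihilator A S)
  have hI := h.localizedSubmodule_le ((Module.annihilator A S).restrictScalars R)
  have hxI : f x ∈ localizedSubmodule R' f ((Module.annihilator A S).restrictScalars R) :=
    apply_mem_localizedSubmodule hx
  have hle' : localizedSubmodule R' f ((Module.annihilator A S).restrictScalars R) ≤
      Subalgebra.toSubmodule B * Submodule.span R' {f x} ⊔ IsLocalRing.maximalIdeal R' •
        localizedSubmodule R' f ((Module.annihilator A S).restrictScalars R) := by
    refine (Submodule.span_le.2 ?_)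
    rintro _ ⟨z, hz, rfl⟩
    obtain ⟨u, hu, w, hw, rfl⟩ := Submodule.mem_sup.1 (hle hz)
    obtain ⟨a, rfl⟩ := Submodule.mem_span_singleton.1 hu
    rw [map_add]
    refine Submodule.add_mem_sup ?_ ?_
    · rw [smul_eq_mul, map_mul]
      exact Submodule.mul_mem_mul (h.apply_mem a) (Submodule.mem_span_singleton_self _)
    · have hw' := apply_mem_localizedSubmodule (R' := R') (f := f)
        (show w ∈ (extendedIdeal A m * Module.annihilator A S).restrictScalars R from hw)
      rw [Submodule.restrictScalars_mul, localizedSubmodule_mul, h.localizedSubmodule_extendedIdeal,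
        IsLocalization.AtPrime.map_eq_maximalIdeal m R'] at hw'
      rw [← Submodule.top_smul (R := R')
        (localizedSubmodule R' f ((Module.annihilator A S).restrictScalars R))] at hw'
      have := smul_mul_smul_le _ ⊤ _ _ hw'
      rwa [Ideal.mul_top, hBI] at this
  have hIx := Submodule.le_of_le_smul_of_le_jacobson_bot (hB.fg.of_le hI)
    (IsLocalRing.jacobson_eq_maximalIdeal (R := R') _ bot_ne_top).ge hle'
  generalize localizedSubmodule R' f ((Module.annihilator A S).restrictScalars R) = I at *
  obtain ⟨Y, hY⟩ := exists_isInverseIdeal_of_forall_mem_iff B hB.fg hB.isUnit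
    hB.exists_pow_smul_mem (hI hxI)
    (I := I) (fun y => ⟨fun hy => by
      simpa using Submodule.mem_mul_span_singleton.1 (hIx hy), fun ⟨b, hb, hbx⟩ => by
      rw [← hbx, ← hBI]; exact Submodule.mul_mem_mul hb hxI⟩)
    (fun b hb => by rw [← hIB]; exact Submodule.mul_mem_mul hxI hb) hrI
  exact hB.hasNoFiniteOverring hY hrI h1I hmax

end Criterion

/-! ### Height-one primes and supports -/

section Commutative

/-- By prime avoidance, since the zero divisors of a reduced ring are the elements of its minimal
primes. -/
theorem exists_mem_nonZeroDivisors_of_height_eq_one {R : Type*} [CommRing R] [IsNoetherianRing R]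
    [IsReduced R] {m : Ideal R} [m.IsPrime] (hm : m.height = 1) : ∃ r ∈ m, r ∈ nonZeroDivisors R := by
  by_contra hc
  push Not at hc
  have hsub : (m : Set R) ⊆ ⋃ p ∈ minimalPrimes R, (p : Set R) := fun x hx => by
    have hz := hc x hx
    rw [mem_nonZeroDivisors_iff_right] at hz
    push Not at hz
    obtain ⟨y, hyx, hy⟩ := hz
    have hrad : (⊥ : Ideal R).radical = ⊥ := Ideal.radical_eq_iff.2 Ideal.isRadical_bot
    have : x ∈ ⋃ p ∈ (⊥ : Ideal R).minimalPrimes, (p : Set R) := by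
      rw [Ideal.iUnion_minimalPrimes, hrad]
      exact ⟨y, hy, by rw [mul_comm, hyx]; exact Ideal.zero_mem _⟩
    exact this
  obtain ⟨p, hp, hmp⟩ := (Ideal.subset_union_prime_finite
    (minimalPrimes.finite_of_isNoetherianRing R) (f := id) ⊥ ⊥ fun _ h _ _ => h.1.1).1 hsub
  have : m ∈ minimalPrimes R := by
    rwa [le_antisymm hmp (hp.2 ⟨inferInstance, bot_le⟩ hmp)]
  rw [Ideal.height_eq_zero_iff.2 this] at hm
  exact zero_ne_one hm

section LocalRing

variable {R : Type*} [CommRing R] [IsLocalRing R] [IsNoetherianRing R]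
  (hR : (IsLocalRing.maximalIdeal R).height = 1) {r : R} (hr : r ∈ nonZeroDivisors R)

include hR hr

theorem maximalIdeal_mem_minimalPrimes (hrm : r ∈ IsLocalRing.maximalIdeal R) :
    IsLocalRing.maximalIdeal R ∈ (Ideal.span {r}).minimalPrimes :=
  Ideal.mem_minimalPrimes_of_height_le ((Ideal.span_singleton_le_iff_mem _).2 hrm)
    (hR.le.trans (Ideal.one_le_height_span_singleton_of_mem_nonZeroDivisors hr))

theorem isArtinian_quotient_span_singleton : IsArtinian R (R ⧸ Ideal.span {r}) := by
  by_cases hrm : r ∈ IsLocalRing.maximalIdeal R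
  · have := IsLocalRing.quotient_artinian_of_mem_minimalPrimes_of_isLocalRing _
      (maximalIdeal_mem_minimalPrimes hR hr hrm)
    exact isArtinian_of_surjective_algebraMap (R := R ⧸ Ideal.span {r})
      Ideal.Quotient.mk_surjective
  · rw [IsLocalRing.mem_maximalIdeal, mem_nonunits_iff, not_not] at hrm
    rw [Ideal.span_singleton_eq_top.2 hrm]
    infer_instance

theorem exists_maximalIdeal_pow_le_span_singleton :
    ∃ j, IsLocalRing.maximalIdeal R ^ j ≤ Ideal.span {r} := by
  by_cases hrm : r ∈ IsLocalRing.maximalIdeal R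
  · refine Ideal.exists_pow_le_of_le_radical_of_fg ?_ (IsNoetherian.noetherian _)
    rw [Ideal.radical_eq_sInf]
    refine le_sInf fun q ⟨hq, hqp⟩ => ?_
    exact (maximalIdeal_mem_minimalPrimes hR hr hrm).2 ⟨hqp, hq⟩ (IsLocalRing.le_maximalIdeal hqp.1)
  · rw [IsLocalRing.mem_maximalIdeal, mem_nonunits_iff, not_not] at hrm
    exact ⟨0, by rw [Ideal.span_singleton_eq_top.2 hrm]; exact le_top⟩

end LocalRing

theorem exists_notMem_smul_eq_zero {R M N : Type*} [CommRing R] [AddCommGroup M] [Module R M]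
    [AddCommGroup N] [Module R N] [Module.Finite R M] (m : Ideal R) [m.IsPrime] (g : M →ₗ[R] N)
    (hg : ∀ x, ∃ s ∉ m, s • g x = 0) : ∃ s ∉ m, ∀ x, s • g x = 0 := by
  suffices ∀ M' : Submodule R M, M'.FG → ∃ s ∉ m, ∀ x ∈ M', s • g x = 0 by
    obtain ⟨s, hs, h⟩ := this ⊤ Module.Finite.fg_top
    exact ⟨s, hs, fun x => h x trivial⟩
  intro M' hM'
  induction M', hM' using Submodule.fg_induction with
  | singleton x =>
    obtain ⟨s, hs, h⟩ := hg x
    refine ⟨s, hs, fun y hy => ?_⟩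
    obtain ⟨a, rfl⟩ := Submodule.mem_span_singleton.1 hy
    rw [map_smul, smul_comm, h, smul_zero]
  | sup M₁ M₂ _ _ h₁ h₂ =>
    obtain ⟨s, hs, h₁⟩ := h₁
    obtain ⟨t, ht, h₂⟩ := h₂
    refine ⟨s * t, m.primeCompl.mul_mem hs ht, fun z hz => ?_⟩
    obtain ⟨x, hx, y, hy, rfl⟩ := Submodule.mem_sup.1 hz
    rw [map_add, smul_add, mul_smul, mul_smul, h₂ y hy, smul_comm, h₁ x hx, smul_zero, smul_zero,
      add_zero]

/-- A finite module with one-point support is supported at a maximal ideal. -/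
theorem isMaximal_of_support_eq_singleton {R M : Type*} [CommRing R] [AddCommGroup M] [Module R M]
    [Module.Finite R M] {m : PrimeSpectrum R} (h : Module.support R M = {m}) :
    m.asIdeal.IsMaximal := by
  obtain ⟨n, hn, hle⟩ := Ideal.exists_le_maximal m.asIdeal m.2.ne_top
  have hmem : (⟨n, hn.isPrime⟩ : PrimeSpectrum R) ∈ Module.support R M := by
    have hm : m ∈ Module.support R M := h ▸ rfl
    rw [Module.support_eq_zeroLocus] at hm ⊢
    exact hm.trans hle
  rw [h] at hmem
  rwa [← (congrArg PrimeSpectrum.asIdeal hmem : n = m.asIdeal)]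

theorem smul_eq_zero_of_support_eq_singleton {R A S : Type*} [CommRing R] [Ring A] [Algebra R A]
    [AddCommGroup S] [Module A S] [IsSimpleModule A S] [Module R S] [IsScalarTower R A S]
    [Module.Finite R S] {m : PrimeSpectrum R} (h : Module.support R S = {m}) {c : R}
    (hc : c ∈ m.asIdeal) (s : S) : algebraMap R A c • s = 0 := by
  have hrad : m.asIdeal = (Module.annihilator R S).radical := by
    rw [← PrimeSpectrum.vanishingIdeal_zeroLocus_eq_radical, ← Module.support_eq_zeroLocus, h,
      PrimeSpectrum.vanishingIdeal_singleton]
  rw [hrad] at hc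
  obtain ⟨n, hn⟩ := hc
  let N : Submodule A S :=
    { carrier := {s | algebraMap R A c • s = 0}
      add_mem' := fun {x y} hx hy => by
        rw [Set.mem_ofPred_eq] at *; rw [smul_add, hx, hy, add_zero]
      zero_mem' := smul_zero _
      smul_mem' := fun a x hx => by
        rw [Set.mem_ofPred_eq] at *; rw [smul_smul, Algebra.commutes, mul_smul, hx, smul_zero] }
  rcases eq_bot_or_eq_top N with hN | hN
  · have key : ∀ k, ∀ t : S, algebraMap R A c ^ k • t = 0 → t = 0 := by
      intro k
      induction k with
      | zero => intro t ht; simpa using ht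
      | succ k ih =>
        intro t ht
        rw [pow_succ, mul_smul] at ht
        have : t ∈ N := ih _ ht
        rwa [hN] at this
    rw [key n s (by rw [← map_pow, algebraMap_smul]; exact Module.mem_annihilator.1 hn s),
      smul_zero]
  · exact (hN ▸ Submodule.mem_top : s ∈ N)

end Commutative

/-! ### The localized order -/

section LocalizedOrder

theorem IsLocalOrder.isMaximalOrder_iff {R L : Type*} [CommRing R] [IsLocalRing R] [Ring L]
    [Algebra R L] {B : Subalgebra R L} {r : R} (h : IsLocalOrder B r) (hr : r ∈ nonZeroDivisors R) :
    IsMaximalOrder B ↔ HasNoFiniteOverring B := by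
  have hden : ∀ C : Subalgebra R L, B ≤ C → ∀ z : L, ∃ d ∈ nonZeroDivisors R, d • z ∈ C :=
    fun C hC z => by
      obtain ⟨k, hk⟩ := h.exists_pow_smul_mem z
      exact ⟨r ^ k, pow_mem hr k, hC hk⟩
  exact ⟨fun hB C hC hBC => hB.eq_of_le C ⟨hC, hden C hBC⟩ hBC,
    fun hB => ⟨⟨h.fg, hden B le_rfl⟩, fun C hC hBC => hB C hC.fg hBC⟩⟩

variable {R Λ : Type*} [CommRing R] [Ring Λ] [Algebra R Λ] (A : Subalgebra R Λ)
  (R' : Type*) [CommRing R'] [Algebra R R'] (m : Ideal R) [m.IsPrime] [IsLocalization.AtPrime R' m]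

/-- The map `A → R' ⊗ Λ`, `a ↦ 1 ⊗ a`. -/
noncomputable def orderToBaseChange : A →ₐ[R] R' ⊗[R] Λ :=
  (Algebra.TensorProduct.includeRight : Λ →ₐ[R] R' ⊗[R] Λ).comp A.val

variable {R'} in
include m in
theorem exists_smul_eq_one_tmul {M : Type*} [AddCommGroup M] [Module R M] (y : R' ⊗[R] M) :
    ∃ s ∉ m, ∃ x : M, s • y = 1 ⊗ₜ x := by
  obtain ⟨⟨x, s⟩, hx⟩ := IsLocalizedModule.surj m.primeCompl (TensorProduct.mk R R' M 1) y
  exact ⟨s, s.2, x, hx⟩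

variable {R'} in
theorem exists_smul_eq_zero_of_one_tmul {M : Type*} [AddCommGroup M] [Module R M] {x : M}
    (hx : (1 : R') ⊗ₜ[R] x = 0) : ∃ s ∉ m, s • x = 0 := by
  obtain ⟨s, hs⟩ := (IsLocalizedModule.eq_zero_iff m.primeCompl (TensorProduct.mk R R' M 1)).1 hx
  exact ⟨s, s.2, hs⟩

theorem isLocalizedSubalgebra_baseChange :
    IsLocalizedSubalgebra m (orderToBaseChange A R') (A.baseChange R') where
  mem_iff y := by
    constructor
    · rintro ⟨z, rfl⟩
      obtain ⟨s, hs, a, ha⟩ := exists_smul_eq_one_tmul m z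
      refine ⟨s, hs, a, ?_⟩
      have := congrArg (Algebra.TensorProduct.map (AlgHom.id R' R') A.val) ha
      rw [← algebraMap_smul R' s, map_smul, algebraMap_smul] at this
      exact this
    · rintro ⟨s, hs, a, ha⟩
      refine mem_of_smul_mem_of_notMem (N := Subalgebra.toSubmodule (A.baseChange R')) hs ?_
      rw [ha]
      exact Subalgebra.tmul_mem_baseChange a.2 1
  exists_smul_eq_zero a ha := by
    obtain ⟨s, hs, h⟩ := exists_smul_eq_zero_of_one_tmul m (R' := R') (x := (a : Λ)) ha
    exact ⟨s, hs, Subtype.ext h⟩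

include m in
/-- An element `s ∉ m` generates an ideal of `Λ` with an identity element `s l`, so `l` is an inverse
of `s` after localization. -/
theorem includeRight_surjective [IsSemisimpleRing Λ] :
    Function.Surjective (Algebra.TensorProduct.includeRight : Λ →ₐ[R] R' ⊗[R] Λ) := by
  intro y
  obtain ⟨s, hs, x, hx⟩ := exists_smul_eq_one_tmul m y
  let J : Ideal Λ := Ideal.span {algebraMap R Λ s}
  have : J.IsTwoSided := ⟨fun {a} b ha => by
    obtain ⟨c, rfl⟩ := Ideal.mem_span_singleton'.1 ha
    rw [mul_assoc, Algebra.commutes, ← mul_assoc]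
    exact Ideal.mem_span_singleton'.2 ⟨_, rfl⟩⟩
  obtain ⟨e, he, hJ⟩ := exists_mem_forall_mul_eq_self J
  obtain ⟨l, rfl⟩ := Ideal.mem_span_singleton'.1 he
  have key : s • (l * (s • x)) = s • x := by
    have := hJ (s • x) (by
      rw [Algebra.smul_def, Algebra.commutes]; exact Ideal.mem_span_singleton'.2 ⟨_, rfl⟩)
    rw [← Algebra.commutes, ← Algebra.smul_def] at this
    rwa [← smul_mul_assoc]
  have hmem : y - 1 ⊗ₜ (l * x) ∈ (⊥ : Submodule R' (R' ⊗[R] Λ)) := by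
    refine mem_of_smul_mem_of_notMem hs (mem_of_smul_mem_of_notMem hs ?_)
    rw [Submodule.mem_bot, smul_sub, smul_sub, hx, ← TensorProduct.tmul_smul,
      ← TensorProduct.tmul_smul, ← TensorProduct.tmul_smul, ← mul_smul_comm, key, sub_self]
  exact ⟨l * x, (sub_eq_zero.1 hmem).symm⟩

variable {A m}

theorem isLocalOrder_baseChange [IsNoetherianRing R] [IsLocalRing R'] (hA : IsCentralOrder A)
    (hm : m.height = 1) {r : R} (hrm : r ∈ m)
    (hr : r ∈ nonZeroDivisors R) (hrΛ : IsUnit (algebraMap R Λ r)) :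
    IsLocalOrder (A.baseChange R') (algebraMap R R' r) := by
  have hloc := isLocalizedSubalgebra_baseChange A R' m
  have := IsLocalization.isNoetherianRing m.primeCompl R' inferInstance
  have hm' : (IsLocalRing.maximalIdeal R').height = 1 := by
    rw [← hm, ← IsLocalization.height_under m.primeCompl, ← IsLocalization.AtPrime.under_maximalIdeal R' m]
  have hnzd : ∀ d ∈ nonZeroDivisors R, algebraMap R R' d ∈ nonZeroDivisors R' := fun d hd =>
    IsLocalization.map_nonZeroDivisors_le m.primeCompl R' ⟨d, hd, rfl⟩
  have hr' := hnzd r hr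
  have hrm' : algebraMap R R' r ∈ IsLocalRing.maximalIdeal R' :=
    (IsLocalization.AtPrime.to_map_mem_maximal_iff R' m r).2 hrm
  have : Module.Finite R A := Module.Finite.iff_fg.2 hA.isOrder.fg
  constructor
  · exact Module.Finite.iff_fg.1 (Module.Finite.range
      (Algebra.TensorProduct.map (AlgHom.id R' R') A.val).toLinearMap)
  · rw [← IsScalarTower.algebraMap_apply]
    have := hrΛ.map (Algebra.TensorProduct.includeRight : Λ →ₐ[R] R' ⊗[R] Λ)
    rwa [AlgHom.commutes] at this
  · exact hrm'
  · intro z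
    obtain ⟨s, hs, l, hl⟩ := exists_smul_eq_one_tmul m z
    obtain ⟨d, hd, hdl⟩ := hA.isOrder.exists_smul_mem l
    obtain ⟨j, hj⟩ := exists_maximalIdeal_pow_le_span_singleton hm' (hnzd d hd)
    obtain ⟨c, hc⟩ := Ideal.mem_span_singleton'.1 (hj (Ideal.pow_mem_pow hrm' j))
    refine ⟨j, ?_⟩
    rw [← hc, mul_smul, algebraMap_smul]
    refine Subalgebra.smul_mem _ ((hloc.mem_iff _).2 ⟨s, hs, ⟨_, hdl⟩, ?_⟩) c
    rw [smul_comm, hl]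
    exact (TensorProduct.tmul_smul d _ _).symm
  · intro j
    rw [← map_pow]
    exact isArtinian_quotient_span_singleton hm' (hnzd _ (pow_mem hr j))
  · exact exists_maximalIdeal_pow_le_span_singleton hm' hr'
  · intro z hz hcomm
    obtain ⟨s, hs, a, ha⟩ := (hloc.mem_iff _).1 hz
    obtain ⟨t, ht, hta⟩ := exists_notMem_smul_eq_zero m
      (LinearMap.mulLeft R a - LinearMap.mulRight R a) fun b => hloc.exists_smul_eq_zero _ (by
        have := hcomm _ (hloc.apply_mem b)
        rw [LinearMap.sub_apply, LinearMap.mulLeft_apply, LinearMap.mulRight_apply, map_sub, map_mul,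
          map_mul, ← ha, smul_mul_assoc, mul_smul_comm, this, sub_self])
    have hcen : t • a ∈ Subalgebra.center R A := by
      rw [Subalgebra.mem_center_iff]
      intro b
      have := hta b
      rw [LinearMap.sub_apply, LinearMap.mulLeft_apply, LinearMap.mulRight_apply, smul_sub,
        sub_eq_zero] at this
      rw [mul_smul_comm, smul_mul_assoc, this]
    rw [hA.center_eq] at hcen
    obtain ⟨c, hc⟩ := Algebra.mem_bot.1 hcen
    have hmem : z ∈ (⊥ : Subalgebra R' (R' ⊗[R] Λ)) := by
      refine mem_of_smul_mem_of_notMem (N := Subalgebra.toSubmodule ⊥)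
        (m.primeCompl.mul_mem ht hs : t * s ∉ m) ?_
      rw [mul_smul, ha, ← map_smul, ← hc, AlgHom.commutes, IsScalarTower.algebraMap_apply R R']
      exact Subalgebra.algebraMap_mem _ _
    exact Algebra.mem_bot.1 hmem

end LocalizedOrder

theorem theoremT {R : Type u} {K : Type*} {Λ : Type v}
    [CommRing R] [IsNoetherianRing R] [IsReduced R] (hR : ringKrullDim R = 1)
    [CommRing K] [Algebra R K] [IsFractionRing R K]
    [Ring Λ] [IsSemisimpleRing Λ] [Algebra R Λ] [Algebra K Λ] [IsScalarTower R K Λ]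
    (A : Subalgebra R Λ) (hA : IsCentralOrder A)
    (S : Type v) [AddCommGroup S] [Module A S] [IsSimpleModule A S]
    [Module R S] [IsScalarTower R A S]
    (m : PrimeSpectrum R) (hm : m.asIdeal.height = 1) (hS : Module.support R S = {m}) :
    IsMaximalOrder (localizedOrder A m) ↔
      Module.length (Module.End A S)
          (Abelian.Ext (ModuleCat.of A S) (ModuleCat.of A S) 1) = 1 ∧
        ∀ (T : Type v) [AddCommGroup T] [Module A T] [IsSimpleModule A T],
          IsEmpty (T ≃ₗ[A] S) →
            Subsingleton (Abelian.Ext (ModuleCat.of A S) (ModuleCat.of A T) 1) := by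
  have : Module.Finite R A := Module.Finite.iff_fg.2 hA.isOrder.fg
  have : Module.Finite R S := Module.Finite.trans A S
  have : m.asIdeal.IsMaximal := isMaximal_of_support_eq_singleton hS
  have hmS : ∀ c ∈ m.asIdeal, ∀ s : S, algebraMap R A c • s = 0 := fun c hc s =>
    smul_eq_zero_of_support_eq_singleton hS hc s
  obtain ⟨r, hrm, hr⟩ := exists_mem_nonZeroDivisors_of_height_eq_one hm
  have hrΛ : IsUnit (algebraMap R Λ r) := by
    rw [IsScalarTower.algebraMap_apply R K]
    exact (IsLocalization.map_units K (⟨r, hr⟩ : nonZeroDivisors R)).map (algebraMap K Λ)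
  have : IsNoetherianRing (Localization.AtPrime m.asIdeal) :=
    IsLocalization.isNoetherianRing m.asIdeal.primeCompl _ inferInstance
  have : IsSemisimpleRing (Localization.AtPrime m.asIdeal ⊗[R] Λ) :=
    RingHom.isSemisimpleRing_of_surjective
      (Algebra.TensorProduct.includeRight :
        Λ →ₐ[R] Localization.AtPrime m.asIdeal ⊗[R] Λ).toRingHom
      (includeRight_surjective _ m.asIdeal)
  have hloc := isLocalizedSubalgebra_baseChange A (Localization.AtPrime m.asIdeal) m.asIdeal
  have hB := isLocalOrder_baseChange (Localization.AtPrime m.asIdeal) hA hm hrm hr hrΛ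
  rw [hB.isMaximalOrder_iff (IsLocalization.map_nonZeroDivisors_le m.asIdeal.primeCompl _
    ⟨r, hr, rfl⟩), length_ext_eq_one_iff R S]
  constructor
  · intro hmax
    refine ⟨length_conormal_eq_of_hasNoFiniteOverring hloc hrm hB hmS hmax,
      fun T _ _ _ hT => (subsingleton_ext_iff R S T).2 ?_⟩
    exact exists_forall_eq_smul_of_hasNoFiniteOverring hloc hrm hB hmS hmax hT
  · rintro ⟨h1, h2⟩
    exact hasNoFiniteOverring_of_forall_exists_smul hloc hrm hB hmS h1 fun T _ _ _ hT =>
      (subsingleton_ext_iff R S T).1 (h2 T hT)
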